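/- **Theorem.** Let $1<p\le 2$. For every $\alpha>0$ there is exactly one $\mu=\mu(\alpha)>0$ for which the problem $$-v''(x)=\mu\,\bigl(v(x)^p+v(x)\sin^2 v(x)\bigr),\quad v(x)>0\quad (0<x<1),\qquad v(0)=v(1)=0,$$ has a solution $v\in C^2([0,1])$ with $\|v\|_\infty=\alpha$. Moreover, as $\alpha\to\infty$: (i) if $1<p<2$, then $$\mu(\alpha)=2(p+1)\alpha^{1-p}\Bigl\{C_{0,p}+\bigl(C_1+\tfrac12C_{11}\bigr)\alpha^{1-p}+(C_2+C_3)\alpha^{2(1-p)}+o(\alpha^{2(1-p)})\Bigr\}^2;$$ (ii) if $p=2$, then $$\mu(\alpha)=6\alpha^{-1}\Bigl\{C_{0,2}+\bigl(C_1+\tfrac12C_{11}\bigr)\alpha^{-1}+\bigl(\tfrac12C_{12}+\tfrac12C_{21}+C_2+C_3\bigr)\alpha^{-2}+o(\alpha^{-2})\Bigr\}^2.$$ Here $C_{0,p},C_1,C_2$ depend only on $p$, while $C_{11},C_{12},C_{21},C_3$ depend on $p$ and $\alpha$: $$C_{0,p}=\int_0^1\frac{ds}{\sqrt{1-s^{p+1}}},\qquad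 C_1=-\frac{p+1}{8}\int_0^1\frac{1-s^2}{(1-s^{p+1})^{3/2}}\,ds,\qquad C_2=\frac{3(p+1)^2}{128}\int_0^1\frac{(1-s^2)^2}{(1-s^{p+1})^{5/2}}\,ds,$$ $$C_{11}=\frac{2}{p+1}\int_0^{\pi/2}\cos\bigl(2\alpha\sin^{2/(p+1)}\theta\bigr)\sin^{(3-p)/(p+1)}\theta\,d\theta,$$ $$C_{12}=\frac{p-1}{2(p+1)}\int_0^{\pi/2}\bigl(\sin2\alpha-\sin(2\alpha\sin^{2/(p+1)}\theta)\bigr)\sin^{(1-p)/(p+1)}\theta\,d\theta+\frac{p+1}{4}\int_0^1\frac{1-s}{(1-s^{p+1})^{3/2}}\sin(2\alpha s)\,ds,$$ $$C_{21}=-\frac{1}{p+1}\int_0^{\pi/2}\sin\bigl(2\alpha\sin^{2/(p+1)}\theta\bigr)\sin^{(3-p)/(p+1)}\theta\,d\theta,$$ $$C_3=-\frac{3}{32}(p+1)^2\int_0^1\left(\int_0^s\frac{1-y^2}{(1-y^{p+1})^{5/2}}\,dy\right)\cos(2\alpha s)\,ds.$$ -/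

import Mathlib

open Real Set Filter Topology MeasureTheory Asymptotics

namespace OscBif

noncomputable section

/-- `v` is a positive `C²([0,1])` solution of
`-v'' = μ (v^p + v sin² v)` on `(0,1)` with `v(0) = v(1) = 0`.
(The two-sided derivatives are taken only at interior points, where `v` is `C²`.) -/
structure IsSolution (p μ : ℝ) (v : ℝ → ℝ) : Prop where
  contDiffOn : ContDiffOn ℝ 2 v (Icc 0 1)
  ode : ∀ x ∈ Ioo (0 : ℝ) 1,
    -deriv (deriv v) x = μ * ((v x) ^ p + v x * (sin (v x)) ^ 2)
  pos : ∀ x ∈ Ioo (0 : ℝ) 1, 0 < v x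
  left : v 0 = 0
  right : v 1 = 0

/-- `μ > 0` is a parameter for which the problem has a solution `v` with
sup norm `‖v‖_∞ = α`. -/
def IsBifurcationValue (p α μ : ℝ) : Prop :=
  0 < μ ∧ ∃ v : ℝ → ℝ, IsSolution p μ v ∧ IsLUB ((fun x => |v x|) '' Icc (0 : ℝ) 1) α

def C0 (p : ℝ) : ℝ := ∫ s in (0 : ℝ)..1, 1 / √(1 - s ^ (p + 1))

def C1 (p : ℝ) : ℝ :=
  -((p + 1) / 8) * ∫ s in (0 : ℝ)..1, (1 - s ^ 2) / (1 - s ^ (p + 1)) ^ (3 / 2 : ℝ)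

/-- Depends on `α`, through an oscillating integrand; likewise `C12`, `C21`, `C3`. -/
def C11 (p α : ℝ) : ℝ :=
  2 / (p + 1) * ∫ θ in (0 : ℝ)..(π / 2),
    cos (2 * α * sin θ ^ (2 / (p + 1))) * sin θ ^ ((3 - p) / (p + 1))

def C12 (p α : ℝ) : ℝ :=
  (p - 1) / (2 * (p + 1)) * (∫ θ in (0 : ℝ)..(π / 2),
    (sin (2 * α) - sin (2 * α * sin θ ^ (2 / (p + 1)))) * sin θ ^ ((1 - p) / (p + 1)))
  + (p + 1) / 4 * ∫ s in (0 : ℝ)..1,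
    (1 - s) / (1 - s ^ (p + 1)) ^ (3 / 2 : ℝ) * sin (2 * α * s)

def C21 (p α : ℝ) : ℝ :=
  -(1 / (p + 1)) * ∫ θ in (0 : ℝ)..(π / 2),
    sin (2 * α * sin θ ^ (2 / (p + 1))) * sin θ ^ ((3 - p) / (p + 1))

def C2 (p : ℝ) : ℝ :=
  3 * (p + 1) ^ 2 / 128 *
    ∫ s in (0 : ℝ)..1, (1 - s ^ 2) ^ 2 / (1 - s ^ (p + 1)) ^ (5 / 2 : ℝ)

def C3 (p α : ℝ) : ℝ :=
  -(3 / 32) * (p + 1) ^ 2 * ∫ s in (0 : ℝ)..1,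
    (∫ y in (0 : ℝ)..s, (1 - y ^ 2) / (1 - y ^ (p + 1)) ^ (5 / 2 : ℝ)) * cos (2 * α * s)

end

end OscBif

/-! Existence and uniqueness come from the time map. A solution conserves `v' ^ 2 / 2 + μ *
potential p v`, so it is strictly monotone on each side of its maximum, and changing variables on
either side expresses the length of that side through the same integral. The two lengths add up to
1, which forces `μ = 2 * timeMap p α ^ 2` (`IsBifurcationValue.eq_timeMap`). For existence, the
orbit is written as `u = α sin θ`. The angle satisfies an autonomous first order equation whose
speed is continuous and positive even at the turning points, because the potential is a function of
`u ^ 2` and its divided difference stays regular there.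

For the asymptotics, put `h = 1 - s ^ (p + 1)` and `ε = α ^ (1 - p)`. Scaling `u = α s` turns the
time map into the integral of `(h + ε * bump) ^ (-1/2)`. Since `0 ≤ bump ≤ (p + 1) / 2 * h`
uniformly in `α` (`bump_le_mul`), a second order Taylor expansion in `ε` can be integrated with
error `O(ε ^ 3)`. In the first order term, integration by parts against `s * h ^ (-1/2)`
(`integral_div_three_halves`) cancels one power of `1 / α` in `bump` and produces `C11`, `C12`,
`C21`. The second order term converges to `C2` by dominated convergence.

By the Riemann-Lebesgue lemma `C3` and `C21` tend to `0`, so their contributions at order `ε ^ 2`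
lie within the error. `C12` stays bounded and enters with the factor `ε / α`, which is `o(ε ^ 2)` if
`p < 2` and equals `ε ^ 2` if `p = 2`; this separates the two cases. -/

namespace OscBif

/-- With `w = u²`, the nonlinearity is `u ^ p + u sin² u = 2 u * density p w`. -/
noncomputable def density (p w : ℝ) : ℝ := ((√w) ^ (p - 1) + sin (√w) ^ 2) / 2

/-- The primitive of `density p` vanishing at `0`. -/
noncomputable def densityPrim (p w : ℝ) : ℝ := ∫ t in (0 : ℝ)..w, density p t

/-- The (even) primitive of the nonlinearity. -/
noncomputable def potential (p u : ℝ) : ℝ := densityPrim p (u ^ 2)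

/-- The time map, up to the factor `√2`. -/
noncomputable def timeMap (p α : ℝ) : ℝ :=
  ∫ u in Ioo 0 α, 1 / √(potential p α - potential p u)

/-! ### The potential and its closed form. -/

section Potential

variable {p : ℝ}

theorem continuous_density (hp : 1 < p) : Continuous (density p) := by
  unfold density
  have : Continuous fun w : ℝ => (√w) ^ (p - 1) :=
    Real.continuous_sqrt.rpow_const fun _ => Or.inr (by linarith)
  fun_prop

theorem density_pos {w : ℝ} (hw : 0 < w) : 0 < density p w := by
  unfold density
  have : 0 < (√w) ^ (p - 1) := Real.rpow_pos_of_pos (Real.sqrt_pos.2 hw) _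
  positivity

theorem hasDerivAt_densityPrim (hp : 1 < p) (w : ℝ) :
    HasDerivAt (densityPrim p) (density p w) w :=
  ((continuous_density hp).integral_hasStrictDerivAt 0 w).hasDerivAt

theorem two_mul_density_sq (hp : 1 < p) {u : ℝ} (hu : 0 ≤ u) :
    2 * u * density p (u ^ 2) = u ^ p + u * sin u ^ 2 := by
  unfold density
  rw [Real.sqrt_sq hu]
  rcases hu.eq_or_lt with rfl | hu
  · rw [Real.zero_rpow (by linarith : p ≠ 0)]; simp
  · have : u ^ p = u * u ^ (p - 1) := by
      rw [Real.rpow_sub_one hu.ne']; field_simp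
    rw [this]; ring

theorem hasDerivAt_potential (hp : 1 < p) (u : ℝ) :
    HasDerivAt (potential p) (2 * u * density p (u ^ 2)) u := by
  have := (hasDerivAt_densityPrim hp (u ^ 2)).comp u (hasDerivAt_pow 2 u)
  refine HasDerivAt.congr_deriv this ?_
  push_cast; ring

theorem densityPrim_strictMonoOn (hp : 1 < p) : StrictMonoOn (densityPrim p) (Ici 0) := by
  apply strictMonoOn_of_deriv_pos (convex_Ici 0)
  · exact fun w _ => (hasDerivAt_densityPrim hp w).continuousAt.continuousWithinAt
  · intro w hw
    rw [interior_Ici] at hw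
    rw [(hasDerivAt_densityPrim hp w).deriv]
    exact density_pos hw

/-- Both sides vanish at `0` and have the same derivative on `[0, u]`. The closed form is what makes
the scaling `u = α s` explicit. -/
theorem potential_eq (hp : 1 < p) {u : ℝ} (hu : 0 ≤ u) :
    potential p u =
      u ^ (p + 1) / (p + 1) + u ^ 2 / 4 - u * sin (2 * u) / 4 - cos (2 * u) / 8 + 1 / 8 := by
  have hd : ∀ x ∈ Ico 0 u, HasDerivWithinAt (fun x : ℝ => x ^ (p + 1) / (p + 1) + x ^ 2 / 4
      - x * sin (2 * x) / 4 - cos (2 * x) / 8 + 1 / 8) (2 * x * density p (x ^ 2)) (Ici x) x := by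
    intro x hx
    rw [two_mul_density_sq hp hx.1]
    have h1 := (Real.hasDerivAt_rpow_const (x := x) (p := p + 1) (Or.inr (by linarith))).div_const
      (p + 1)
    have h2 := (hasDerivAt_pow 2 x).div_const 4
    have h0 : HasDerivAt (fun x : ℝ => 2 * x) 2 x := by
      simpa using (hasDerivAt_id x).const_mul (2 : ℝ)
    have h3 := ((hasDerivAt_id x).mul ((Real.hasDerivAt_sin (2 * x)).comp x h0)).div_const 4
    have h4 := (((Real.hasDerivAt_cos (2 * x)).comp x h0)).div_const 8
    have h := (((h1.add h2).sub h3).sub h4).add_const (1 / 8 : ℝ)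
    refine HasDerivAt.hasDerivWithinAt ?_
    refine HasDerivAt.congr_deriv h ?_
    have : p + 1 ≠ 0 := by linarith
    have hc : sin x ^ 2 = (1 - cos (2 * x)) / 2 := by
      rw [Real.cos_two_mul, Real.cos_sq']; ring
    rw [hc]
    simp only [add_sub_cancel_right, Function.comp, id]
    field_simp
    push_cast
    ring
  refine eq_of_has_deriv_right_eq (a := 0) (b := u)
    (fun x _ => (hasDerivAt_potential hp x).hasDerivWithinAt) hd ?_ ?_ ?_ u ⟨hu, le_rfl⟩
  · exact fun x _ => (hasDerivAt_potential hp x).continuousAt.continuousWithinAt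
  · have : Continuous fun x : ℝ => x ^ (p + 1) :=
      continuous_id.rpow_const fun _ => Or.inr (by linarith)
    fun_prop
  · have : p + 1 ≠ 0 := by linarith
    simp [potential, densityPrim, Real.zero_rpow this]

end Potential

/-! ### Conservation of energy and the time map formula. -/

section Uniqueness

variable {p μ : ℝ} {v : ℝ → ℝ}

theorem IsSolution.hasDerivAt (hv : IsSolution p μ v) {x : ℝ} (hx : x ∈ Ioo (0 : ℝ) 1) :
    HasDerivAt v (deriv v x) x :=
  ((hv.contDiffOn.contDiffAt (Icc_mem_nhds hx.1 hx.2)).differentiableAt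
    (by norm_num)).hasDerivAt

theorem IsSolution.hasDerivAt_deriv (hv : IsSolution p μ v) {x : ℝ} (hx : x ∈ Ioo (0 : ℝ) 1) :
    HasDerivAt (deriv v) (deriv (deriv v) x) x := by
  have h : ContDiffOn ℝ (1 + 1) v (Ioo 0 1) :=
    (hv.contDiffOn.mono Ioo_subset_Icc_self).of_le (by norm_num)
  have h1 := ((contDiffOn_succ_iff_deriv_of_isOpen isOpen_Ioo).1 h).2.2
  exact ((h1.contDiffAt (isOpen_Ioo.mem_nhds hx)).differentiableAt (by norm_num)).hasDerivAt

theorem IsSolution.energy (hp : 1 < p) (hv : IsSolution p μ v) {x y : ℝ}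
    (hx : x ∈ Ioo (0 : ℝ) 1) (hy : y ∈ Ioo (0 : ℝ) 1) :
    deriv v x ^ 2 / 2 + μ * potential p (v x) = deriv v y ^ 2 / 2 + μ * potential p (v y) := by
  have key : ∀ z ∈ Ioo (0 : ℝ) 1,
      HasDerivAt (fun x => deriv v x ^ 2 / 2 + μ * potential p (v x)) 0 z := by
    intro z hz
    have h1 := ((hv.hasDerivAt_deriv hz).pow 2).div_const 2
    have h2 := ((hasDerivAt_potential hp (v z)).comp z (hv.hasDerivAt hz)).const_mul μ
    refine HasDerivAt.congr_deriv (h1.add h2) ?_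
    have h3 := hv.ode z hz
    rw [two_mul_density_sq hp (hv.pos z hz).le]
    have h4 : deriv (deriv v) z = -(μ * (v z ^ p + v z * sin (v z) ^ 2)) := by linarith
    rw [h4]; push_cast; ring
  exact isOpen_Ioo.is_const_of_deriv_eq_zero isPreconnected_Ioo
    (fun z hz => (key z hz).differentiableAt.differentiableWithinAt)
    (fun z hz => (key z hz).deriv) hx hy

/-- A bifurcation value is determined by the time map. -/
theorem IsBifurcationValue.eq_timeMap {α : ℝ} (hp : 1 < p) (hα : 0 < α)
    (h : IsBifurcationValue p α μ) : μ = 2 * timeMap p α ^ 2 := by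
  obtain ⟨hμ, v, hv, hlub⟩ := h
  have hc : ContinuousOn v (Icc 0 1) := hv.contDiffOn.continuousOn
  have hnn : ∀ x ∈ Icc (0 : ℝ) 1, 0 ≤ v x := by
    intro x hx
    rcases hx.1.eq_or_lt with rfl | h0
    · exact hv.left.ge
    rcases hx.2.eq_or_lt with rfl | h1
    · exact hv.right.ge
    · exact (hv.pos x ⟨h0, h1⟩).le
  have hle : ∀ x ∈ Icc (0 : ℝ) 1, v x ≤ α := fun x hx =>
    (le_abs_self _).trans (hlub.1 ⟨x, hx, rfl⟩)
  obtain ⟨c, hcI, hcmax⟩ := isCompact_Icc.exists_isMaxOn (nonempty_Icc.2 zero_le_one) hc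
  have hvc : v c = α := by
    refine le_antisymm (hle c hcI) (hlub.2 ?_)
    rintro _ ⟨x, hx, rfl⟩
    show |v x| ≤ v c
    rw [abs_of_nonneg (hnn x hx)]
    exact hcmax hx
  have hcO : c ∈ Ioo (0 : ℝ) 1 := by
    refine ⟨lt_of_le_of_ne hcI.1 ?_, lt_of_le_of_ne hcI.2 ?_⟩
    · rintro rfl; rw [hv.left] at hvc; exact hα.ne hvc
    · rintro rfl; rw [hv.right] at hvc; exact hα.ne hvc
  have hdc : deriv v c = 0 :=
    (hcmax.isLocalMax (Icc_mem_nhds hcO.1 hcO.2)).deriv_eq_zero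
  have hanti : StrictAntiOn (deriv v) (Ioo 0 1) := by
    apply strictAntiOn_of_deriv_neg (convex_Ioo 0 1)
    · exact fun x hx => (hv.hasDerivAt_deriv hx).continuousAt.continuousWithinAt
    · intro x hx
      rw [interior_Ioo] at hx
      have h1 := hv.ode x hx
      have h2 := Real.rpow_pos_of_pos (hv.pos x hx) p
      have h3 := (hv.pos x hx).le
      have : 0 < μ * (v x ^ p + v x * sin (v x) ^ 2) := by positivity
      linarith
  have hpos : ∀ x ∈ Ioo 0 c, 0 < deriv v x := fun x hx => by
    rw [← hdc]; exact hanti ⟨hx.1, hx.2.trans hcO.2⟩ hcO hx.2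
  have hneg : ∀ x ∈ Ioo c 1, deriv v x < 0 := fun x hx => by
    rw [← hdc]; exact hanti hcO ⟨hcO.1.trans hx.1, hx.2⟩ hx.1
  -- Compare the energy at `x` with the energy at the maximum point `c`, where the kinetic part
  -- vanishes.
  have habs : ∀ x ∈ Ioo (0 : ℝ) 1,
      |deriv v x| = √(2 * μ) * √(potential p α - potential p (v x)) := by
    intro x hx
    rw [← Real.sqrt_mul (by positivity), ← Real.sqrt_sq_eq_abs]
    congr 1
    have := hv.energy hp hx hcO
    rw [hdc, hvc] at this
    linarith
  have hmono : StrictMonoOn v (Icc 0 c) := by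
    apply strictMonoOn_of_deriv_pos (convex_Icc 0 c) (hc.mono (Icc_subset_Icc_right hcO.2.le))
    intro x hx; rw [interior_Icc] at hx; exact hpos x hx
  have hmono' : StrictAntiOn v (Icc c 1) := by
    apply strictAntiOn_of_deriv_neg (convex_Icc c 1) (hc.mono (Icc_subset_Icc_left hcO.1.le))
    intro x hx; rw [interior_Icc] at hx; exact hneg x hx
  have him : v '' Ioo 0 c = Ioo 0 α := by
    apply Subset.antisymm
    · rintro _ ⟨x, hx, rfl⟩
      refine ⟨hv.pos x ⟨hx.1, hx.2.trans hcO.2⟩, ?_⟩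
      rw [← hvc]
      exact hmono ⟨hx.1.le, hx.2.le⟩ ⟨hcO.1.le, le_rfl⟩ hx.2
    · have := intermediate_value_Ioo hcO.1.le (hc.mono (Icc_subset_Icc_right hcO.2.le))
      rwa [hv.left, hvc] at this
  have him' : v '' Ioo c 1 = Ioo 0 α := by
    apply Subset.antisymm
    · rintro _ ⟨x, hx, rfl⟩
      refine ⟨hv.pos x ⟨hcO.1.trans hx.1, hx.2⟩, ?_⟩
      rw [← hvc]
      exact hmono' ⟨le_rfl, hcO.2.le⟩ ⟨hx.1.le, hx.2.le⟩ hx.1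
    · have := intermediate_value_Ioo' hcO.2.le (hc.mono (Icc_subset_Icc_left hcO.1.le))
      rwa [hv.right, hvc] at this
  -- After the substitution `u = v x` the integrand becomes the constant `√(2 * μ)`. Applied to both
  -- sides of `c`, this avoids proving that `v` is symmetric, and the change of variables needs no
  -- integrability at the singular end `u = α`.
  have hcov : ∀ s : Set ℝ, MeasurableSet s → s ⊆ Ioo 0 1 → InjOn v s → v '' s = Ioo 0 α →
      (∀ x ∈ s, deriv v x ≠ 0) → timeMap p α = √(2 * μ) * volume.real s := by
    intro s hs hs1 hinj hims hne
    have := integral_image_eq_integral_abs_deriv_smul hs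
      (fun x hx => (hv.hasDerivAt (hs1 hx)).hasDerivWithinAt) hinj
      (fun u => 1 / √(potential p α - potential p u))
    rw [timeMap, ← hims, this, setIntegral_congr_fun (g := fun _ => √(2 * μ)) hs]
    · simp [mul_comm]
    · intro x hx
      have h1 := habs x (hs1 hx)
      have h2 : √(potential p α - potential p (v x)) ≠ 0 := by
        intro h0
        rw [h0, mul_zero, abs_eq_zero] at h1
        exact hne x hx h1
      simp only [smul_eq_mul]
      rw [h1]; field_simp
  have e1 := hcov (Ioo 0 c) measurableSet_Ioo (Ioo_subset_Ioo_right hcO.2.le)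
    (hmono.injOn.mono Ioo_subset_Icc_self) him fun x hx => (hpos x hx).ne'
  have e2 := hcov (Ioo c 1) measurableSet_Ioo (Ioo_subset_Ioo_left hcO.1.le)
    (hmono'.injOn.mono Ioo_subset_Icc_self) him' fun x hx => (hneg x hx).ne
  rw [Real.volume_real_Ioo_of_le hcO.1.le] at e1
  rw [Real.volume_real_Ioo_of_le hcO.2.le] at e2
  have e3 : 2 * timeMap p α = √(2 * μ) := by linarith
  have e4 : √(2 * μ) ^ 2 = 2 * μ := Real.sq_sqrt (by positivity)
  rw [← e3] at e4
  linarith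

end Uniqueness

end OscBif

/-! ### Two differentiation rules for merely continuous factors and roots. -/

/-- The difference quotient at a zero of `f` is the slope of `f` times `g y`, so continuity of `g`
suffices. It handles the turning points, where the speed is only known to be continuous. -/
theorem HasDerivAt.mul_of_eq_zero {f g : ℝ → ℝ} {f' x : ℝ} (hf : HasDerivAt f f' x)
    (hg : ContinuousAt g x) (h0 : f x = 0) : HasDerivAt (fun y => f y * g y) (f' * g x) x := by
  rw [hasDerivAt_iff_tendsto_slope] at hf ⊢
  refine (hf.mul (hg.tendsto.mono_left nhdsWithin_le_nhds)).congr fun y => ?_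
  simp only [slope_def_field, h0]
  ring

/-- Divide the slope of `f ^ 2` by `f y + f x`, which tends to `2 * f x ≠ 0`. -/
theorem HasDerivAt.of_sq {f E : ℝ → ℝ} {c x : ℝ} (hE : HasDerivAt E (2 * f x * c) x)
    (hf : ContinuousAt f x) (h0 : f x ≠ 0) (h : ∀ y, f y ^ 2 = E y) : HasDerivAt f c x := by
  rw [hasDerivAt_iff_tendsto_slope] at hE ⊢
  have h1 : Tendsto (fun y => f y + f x) (𝓝[≠] x) (𝓝 (f x + f x)) :=
    (hf.tendsto.mono_left nhdsWithin_le_nhds).add_const _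
  have h2 : f x + f x ≠ 0 := by simpa [← two_mul] using h0
  have h3 := hE.div h1 h2
  have h4 : 2 * f x * c / (f x + f x) = c := by field_simp; ring
  rw [h4] at h3
  refine h3.congr' ?_
  filter_upwards [h1.eventually_ne h2] with y hy
  simp only [slope_def_field, Pi.div_apply, ← h]
  rw [div_div, mul_comm (y - x), ← div_div]
  congr 1
  rw [div_eq_iff hy]; ring

namespace OscBif

/-! ### Construction of a solution through an angular variable. -/

section Existence

/-- The angular speed of the orbit of amplitude `α` of `u'' = -(u ^ p + u sin² u)`,
parametrised by `u = α sin φ`. -/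
noncomputable def speed (p α φ : ℝ) : ℝ :=
  √(2 * dslope (densityPrim p) (α ^ 2) (α ^ 2 * sin φ ^ 2))

/-- The time needed to reach the angle `φ`. -/
noncomputable def angleTime (p α φ : ℝ) : ℝ := ∫ t in (0 : ℝ)..φ, 1 / speed p α t

variable {p α : ℝ}

theorem continuous_dslope_densityPrim (hp : 1 < p) :
    Continuous (dslope (densityPrim p) (α ^ 2)) := by
  rw [← continuousOn_univ, continuousOn_dslope univ_mem]
  exact ⟨fun w _ => (hasDerivAt_densityPrim hp w).continuousAt.continuousWithinAt,
    (hasDerivAt_densityPrim hp _).differentiableAt⟩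

theorem sq_mul_sin_sq_le (α φ : ℝ) : α ^ 2 * sin φ ^ 2 ≤ α ^ 2 :=
  mul_le_of_le_one_right (sq_nonneg _) (sin_sq_le_one φ)

/-- The divided difference is a secant slope of a strictly increasing function or, at a turning
point, the value of the positive density. -/
theorem dslope_densityPrim_pos (hp : 1 < p) (hα : 0 < α) (φ : ℝ) :
    0 < dslope (densityPrim p) (α ^ 2) (α ^ 2 * sin φ ^ 2) := by
  rcases (sq_mul_sin_sq_le α φ).eq_or_lt with h | h
  · rw [h, dslope_same, (hasDerivAt_densityPrim hp _).deriv]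
    exact density_pos (by positivity)
  · rw [dslope_of_ne _ h.ne, slope_def_field]
    have := densityPrim_strictMonoOn hp (a := α ^ 2 * sin φ ^ 2) (b := α ^ 2)
      (mem_Ici.2 (by positivity)) (mem_Ici.2 (by positivity)) h
    exact div_pos_of_neg_of_neg (by linarith) (by linarith)

theorem continuous_speed (hp : 1 < p) : Continuous (speed p α) := by
  unfold speed
  have := continuous_dslope_densityPrim (α := α) hp
  fun_prop

theorem speed_pos (hp : 1 < p) (hα : 0 < α) (φ : ℝ) : 0 < speed p α φ :=
  Real.sqrt_pos.2 (mul_pos two_pos (dslope_densityPrim_pos hp hα φ))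

theorem exists_speed_le (hp : 1 < p) (hα : 0 < α) : ∃ C > 0, ∀ φ, speed p α φ ≤ C := by
  obtain ⟨C, hC⟩ := (isCompact_Icc (a := (0 : ℝ)) (b := α ^ 2)).exists_bound_of_continuousOn
    (continuous_dslope_densityPrim (α := α) hp).continuousOn
  have key : ∀ φ, speed p α φ ≤ √(2 * C) := fun φ => by
    refine Real.sqrt_le_sqrt ?_
    have := hC (α ^ 2 * sin φ ^ 2) ⟨by positivity, sq_mul_sin_sq_le α φ⟩
    linarith [le_norm_self (dslope (densityPrim p) (α ^ 2) (α ^ 2 * sin φ ^ 2))]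
  exact ⟨√(2 * C), (speed_pos hp hα 0).trans_le (key 0), key⟩

theorem hasDerivAt_angleTime (hp : 1 < p) (hα : 0 < α) (φ : ℝ) :
    HasDerivAt (angleTime p α) (1 / speed p α φ) φ := by
  have : Continuous fun t => 1 / speed p α t :=
    continuous_const.div (continuous_speed hp) fun t => (speed_pos hp hα t).ne'
  exact (this.integral_hasStrictDerivAt 0 φ).hasDerivAt

theorem angleTime_zero : angleTime p α 0 = 0 := by simp [angleTime]

theorem angleTime_strictMono (hp : 1 < p) (hα : 0 < α) : StrictMono (angleTime p α) :=
  strictMono_of_hasDerivAt_pos (hasDerivAt_angleTime hp hα)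
    fun φ => one_div_pos.2 (speed_pos hp hα φ)

/-- The speed is at most `C`, so `angleTime p α φ - φ / C` is increasing and `angleTime` is
unbounded in both directions. -/
theorem angleTime_surjective (hp : 1 < p) (hα : 0 < α) :
    Function.Surjective (angleTime p α) := by
  obtain ⟨C, hC, hle⟩ := exists_speed_le hp hα
  have hd : ∀ φ, HasDerivAt (fun φ => angleTime p α φ - φ / C) (1 / speed p α φ - 1 / C) φ :=
    fun φ => (hasDerivAt_angleTime hp hα φ).sub ((hasDerivAt_id φ).div_const C)
  have hm : Monotone fun φ => angleTime p α φ - φ / C := by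
    refine monotone_of_deriv_nonneg (fun φ => (hd φ).differentiableAt) fun φ => ?_
    rw [(hd φ).deriv, sub_nonneg]
    exact one_div_le_one_div_of_le (speed_pos hp hα φ) (hle φ)
  refine Continuous.surjective
    (continuous_iff_continuousAt.2 fun φ => (hasDerivAt_angleTime hp hα φ).continuousAt) ?_ ?_
  · refine tendsto_atTop_mono' _ ?_ (tendsto_id.atTop_div_const hC)
    filter_upwards [eventually_ge_atTop 0] with φ hφ
    have := hm hφ
    simp only [angleTime_zero, zero_div, sub_zero] at this
    simpa using this
  · refine tendsto_atBot_mono' _ ?_ (tendsto_id.atBot_div_const hC)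
    filter_upwards [eventually_le_atBot 0] with φ hφ
    have := hm hφ
    simp only [angleTime_zero, zero_div, sub_zero] at this
    simpa using this

/-- The angle as a function of time. -/
theorem exists_angle (hp : 1 < p) (hα : 0 < α) : ∃ θ : ℝ → ℝ, StrictMono θ ∧
    (∀ φ, θ (angleTime p α φ) = φ) ∧ ∀ x, HasDerivAt θ (speed p α (θ x)) x := by
  let e := (angleTime_strictMono hp hα).orderIsoOfSurjective _ (angleTime_surjective hp hα)
  have he : ∀ φ, e φ = angleTime p α φ := fun φ => rfl
  refine ⟨e.symm, e.symm.strictMono, fun φ => ?_, fun x => ?_⟩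
  · rw [← he, e.symm_apply_apply]
  · have := HasDerivAt.of_local_left_inverse e.symm.continuous.continuousAt
      (hasDerivAt_angleTime hp hα (e.symm x))
      (one_div_pos.2 (speed_pos hp hα _)).ne'
      (Eventually.of_forall fun y => by rw [← he, e.apply_symm_apply])
    simpa using this

/-- The energy identity for `u = α sin φ`: since `α ^ 2 cos ^ 2 φ = α ^ 2 - α ^ 2 sin ^ 2 φ`, the
factor in front of the divided difference restores the difference of potentials. -/
theorem sq_cos_mul_speed (hp : 1 < p) (hα : 0 < α) (φ : ℝ) :
    (α * cos φ * speed p α φ) ^ 2 = 2 * (potential p α - potential p (α * sin φ)) := by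
  have h1 := sub_smul_dslope (densityPrim p) (α ^ 2) (α ^ 2 * sin φ ^ 2)
  have h2 : speed p α φ ^ 2 = 2 * dslope (densityPrim p) (α ^ 2) (α ^ 2 * sin φ ^ 2) :=
    Real.sq_sqrt (mul_pos two_pos (dslope_densityPrim_pos hp hα φ)).le
  rw [mul_pow, mul_pow, h2, Real.cos_sq', potential, potential, mul_pow]
  rw [smul_eq_mul] at h1
  linear_combination (-2) * h1

theorem exists_isBifurcationValue (hp : 1 < p) (hα : 0 < α) :
    ∃ μ, IsBifurcationValue p α μ := by
  obtain ⟨θ, hθm, hθi, hθd⟩ := exists_angle hp hα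
  have hθc : Continuous θ := continuous_iff_continuousAt.2 fun x => (hθd x).continuousAt
  set w : ℝ → ℝ := fun x => α * cos (θ x) * speed p α (θ x) with hw
  have hu : ∀ x, HasDerivAt (fun x => α * sin (θ x)) (w x) x := fun x =>
    ((hθd x).sin.const_mul α).congr_deriv (by simp only [hw]; ring)
  have hwc : Continuous w := by
    have := continuous_speed (α := α) hp
    fun_prop
  have hwd : ∀ x, HasDerivAt w
      (-(2 * (α * sin (θ x)) * density p ((α * sin (θ x)) ^ 2))) x := by
    intro x
    -- At a turning point `w` has the vanishing factor `cos`, so only continuity of the speed is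
    -- needed. Elsewhere `w ≠ 0`, and its derivative is read off from the energy identity for `w ^
    -- 2`.
    by_cases h0 : cos (θ x) = 0
    · have h1 := ((hθd x).cos.const_mul α).mul_of_eq_zero
        (((continuous_speed (α := α) hp).comp hθc).continuousAt) (by rw [h0, mul_zero])
      refine HasDerivAt.congr_deriv h1 ?_
      have h2 : sin (θ x) ^ 2 = 1 := by
        have := sin_sq_add_cos_sq (θ x)
        rw [h0] at this; linarith
      have h3 : speed p α (θ x) ^ 2 = 2 * density p (α ^ 2) := by
        have := dslope_densityPrim_pos hp hα (θ x)
        rw [h2, mul_one, dslope_same, (hasDerivAt_densityPrim hp _).deriv] at this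
        rw [speed, Real.sq_sqrt]
        · rw [h2, mul_one, dslope_same, (hasDerivAt_densityPrim hp _).deriv]
        · rw [h2, mul_one, dslope_same, (hasDerivAt_densityPrim hp _).deriv]
          positivity
      rw [mul_pow, h2, mul_one, Function.comp]
      linear_combination (-α * sin (θ x)) * h3
    · have hE : HasDerivAt (fun y => 2 * (potential p α - potential p (α * sin (θ y))))
          (2 * w x * -(2 * (α * sin (θ x)) * density p ((α * sin (θ x)) ^ 2))) x := by
        have := (((hasDerivAt_potential hp (α * sin (θ x))).comp x (hu x)).const_sub
          (potential p α)).const_mul 2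
        exact this.congr_deriv (by ring)
      exact hE.of_sq hwc.continuousAt
        (mul_ne_zero (mul_ne_zero hα.ne' h0) (speed_pos hp hα _).ne')
        fun y => sq_cos_mul_speed hp hα (θ y)
  -- `L` is the time of a half turn, from one zero of `sin θ` to the next. Rescaling `[0, L]` to
  -- `[0, 1]` multiplies the second derivative by `L ^ 2`, which is therefore `μ`.
  set L := angleTime p α π with hL
  have hLpos : 0 < L := by
    rw [hL, ← angleTime_zero (p := p) (α := α)]; exact angleTime_strictMono hp hα pi_pos
  have hθ0 : θ 0 = 0 := by simpa [angleTime_zero] using hθi 0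
  have hθL : θ L = π := hθi π
  set v : ℝ → ℝ := fun x => α * sin (θ (L * x)) with hv
  have hlin : ∀ x, HasDerivAt (fun x => L * x) L x := fun x => by
    simpa using (hasDerivAt_id x).const_mul L
  have hv1 : ∀ x, HasDerivAt v (L * w (L * x)) x := fun x =>
    ((hu (L * x)).comp x (hlin x)).congr_deriv (by ring)
  have hdv : deriv v = fun x => L * w (L * x) := funext fun x => (hv1 x).deriv
  have hv2 : ∀ x, HasDerivAt (deriv v) (-(L ^ 2 * (2 * v x * density p (v x ^ 2)))) x := by
    intro x
    rw [hdv]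
    exact (((hwd (L * x)).comp x (hlin x)).const_mul L).congr_deriv (by simp only [hv]; ring)
  have hddv : deriv (deriv v) = fun x => -(L ^ 2 * (2 * v x * density p (v x ^ 2))) :=
    funext fun x => (hv2 x).deriv
  have hang : ∀ x ∈ Ioo (0 : ℝ) 1, θ (L * x) ∈ Ioo 0 π := by
    intro x hx
    constructor
    · rw [← hθ0]; exact hθm (mul_pos hLpos hx.1)
    · rw [← hθL]; exact hθm (mul_lt_of_lt_one_right hLpos hx.2)
  have hpos : ∀ x ∈ Ioo (0 : ℝ) 1, 0 < v x := fun x hx =>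
    mul_pos hα (sin_pos_of_mem_Ioo (hang x hx))
  refine ⟨L ^ 2, by positivity, v, ⟨?_, ?_, hpos, ?_, ?_⟩, IsGreatest.isLUB ⟨?_, ?_⟩⟩
  · refine ContDiff.contDiffOn ?_
    have hvc : Continuous v := by fun_prop
    have h1 : ContDiff ℝ 1 (deriv v) := by
      rw [contDiff_one_iff_deriv]
      refine ⟨fun x => (hv2 x).differentiableAt, ?_⟩
      rw [hddv]
      have := continuous_density hp
      fun_prop
    rw [show (2 : WithTop ℕ∞) = 1 + 1 by norm_num, contDiff_succ_iff_deriv]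
    exact ⟨fun x => (hv1 x).differentiableAt, by simp, h1⟩
  · intro x hx
    rw [hddv, neg_neg, two_mul_density_sq hp (hpos x hx).le]
  · simp [hv, hθ0]
  · simp [hv, hθL]
  · have hlt : angleTime p α (π / 2) < L := angleTime_strictMono hp hα (by linarith [pi_pos])
    have h0 : 0 < angleTime p α (π / 2) := by
      rw [← angleTime_zero (p := p) (α := α)]
      exact angleTime_strictMono hp hα (by linarith [pi_pos])
    refine ⟨angleTime p α (π / 2) / L, ⟨by positivity, (div_le_one hLpos).2 hlt.le⟩, ?_⟩
    simp only [hv]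
    rw [mul_div_cancel₀ _ hLpos.ne', hθi, sin_pi_div_two, mul_one, abs_of_pos hα]
  · rintro _ ⟨x, -, rfl⟩
    simp only [hv, abs_mul, abs_of_pos hα]
    exact mul_le_of_le_one_right hα.le (abs_sin_le_one _)

theorem existsUnique_isBifurcationValue (hp : 1 < p) (hα : 0 < α) :
    ∃! μ, IsBifurcationValue p α μ := by
  obtain ⟨μ, hμ⟩ := exists_isBifurcationValue hp hα
  exact ⟨μ, hμ, fun ν hν => (hν.eq_timeMap hp hα).trans (hμ.eq_timeMap hp hα).symm⟩

end Existence

end OscBif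

/-! ### Riemann-Lebesgue lemma on `[0, 1]`. -/

section RiemannLebesgue

open Complex in
theorem tendsto_integral_mul_cexp {f : ℝ → ℝ} (hf : IntervalIntegrable f volume 0 1) :
    Tendsto (fun α : ℝ => ((∫ s in (0 : ℝ)..1, f s * Real.cos (2 * α * s) : ℝ) : ℂ)
      - (∫ s in (0 : ℝ)..1, f s * Real.sin (2 * α * s) : ℝ) * I) atTop (𝓝 0) := by
  -- Extend `f` by zero. The Fourier integral at frequency `α / π` has kernel `exp (-2 i α s)`,
  -- whose real and imaginary parts give the cosine and sine integrals.
  set g : ℝ → ℂ := (Ioc (0 : ℝ) 1).indicator fun s => (f s : ℂ) with hg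
  have hw : Tendsto (fun α : ℝ => α / π) atTop (cocompact ℝ) := by
    rw [cocompact_eq_atBot_atTop]
    exact (tendsto_id.atTop_div_const Real.pi_pos).mono_right le_sup_right
  refine ((Real.tendsto_integral_exp_smul_cocompact g).comp hw).congr fun α => ?_
  have hi : ∀ q : ℝ → ℝ, Continuous q →
      IntervalIntegrable (fun s => ((f s * q s : ℝ) : ℂ)) volume 0 1 :=
    fun q hq =>
      have h := hf.mul_continuousOn hq.continuousOn
      ⟨h.1.ofReal, h.2.ofReal⟩
  have h1 : ∀ v : ℝ, Real.fourierChar (-(v * (α / π))) • g v = (Ioc (0 : ℝ) 1).indicator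
      (fun s => ((f s * Real.cos (2 * α * s) : ℝ) : ℂ)
        - ((f s * Real.sin (2 * α * s) : ℝ) : ℂ) * I) v := by
    intro v
    by_cases hv : v ∈ Ioc (0 : ℝ) 1
    · rw [hg, indicator_of_mem hv, indicator_of_mem hv, Circle.smul_def, Real.fourierChar_apply]
      have : 2 * π * -(v * (α / π)) = -(2 * α * v) := by
        have := Real.pi_ne_zero
        field_simp
      rw [this, exp_mul_I, ← ofReal_cos, ← ofReal_sin, Real.cos_neg, Real.sin_neg, smul_eq_mul]
      push_cast; ring
    · rw [hg, indicator_of_notMem hv, indicator_of_notMem hv, smul_zero]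
  simp only [Function.comp]
  simp_rw [h1]
  rw [integral_indicator measurableSet_Ioc, ← intervalIntegral.integral_of_le zero_le_one,
    intervalIntegral.integral_sub (hi _ (by fun_prop)) ((hi _ (by fun_prop)).mul_const I),
    intervalIntegral.integral_mul_const, intervalIntegral.integral_ofReal,
    intervalIntegral.integral_ofReal]

theorem tendsto_integral_mul_cos {f : ℝ → ℝ} (hf : IntervalIntegrable f volume 0 1) :
    Tendsto (fun α : ℝ => ∫ s in (0 : ℝ)..1, f s * cos (2 * α * s)) atTop (𝓝 0) := by
  simpa [Function.comp_def] using
    (Complex.continuous_re.tendsto 0).comp (tendsto_integral_mul_cexp hf)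

theorem tendsto_integral_mul_sin {f : ℝ → ℝ} (hf : IntervalIntegrable f volume 0 1) :
    Tendsto (fun α : ℝ => ∫ s in (0 : ℝ)..1, f s * sin (2 * α * s)) atTop (𝓝 0) := by
  simpa [Function.comp_def] using
    ((Complex.continuous_im.tendsto 0).comp (tendsto_integral_mul_cexp hf)).neg

end RiemannLebesgue

namespace OscBif

/-! ### The singular weight `h = 1 - s ^ (p + 1)`. -/

section Weight

variable {p s : ℝ}

theorem one_sub_sq_le (hp : 1 < p) (hs : s ∈ Icc (0 : ℝ) 1) : 1 - s ^ 2 ≤ 1 - s ^ (p + 1) := by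
  rcases hs.1.eq_or_lt with rfl | h0
  · rw [Real.zero_rpow (by linarith)]; simp
  · have := Real.rpow_le_rpow_of_exponent_ge h0 hs.2 (by linarith : (2 : ℝ) ≤ p + 1)
    rw [Real.rpow_two] at this
    linarith

theorem one_sub_le (hp : 1 < p) (hs : s ∈ Icc (0 : ℝ) 1) : 1 - s ≤ 1 - s ^ (p + 1) := by
  have := one_sub_sq_le hp hs
  nlinarith [hs.1, hs.2]

theorem one_sub_rpow_pos (hp : 1 < p) (hs : s ∈ Ico (0 : ℝ) 1) : 0 < 1 - s ^ (p + 1) := by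
  have := one_sub_le hp ⟨hs.1, hs.2.le⟩
  linarith [hs.2]

theorem rpow_three_halves {h : ℝ} (hh : 0 ≤ h) : h ^ (3 / 2 : ℝ) = √h ^ 3 := by
  rw [Real.rpow_div_two_eq_sqrt _ hh]; norm_cast

theorem rpow_five_halves {h : ℝ} (hh : 0 ≤ h) : h ^ (5 / 2 : ℝ) = √h ^ 5 := by
  rw [Real.rpow_div_two_eq_sqrt _ hh]; norm_cast

theorem continuous_rpow_add_one (hp : 1 < p) : Continuous fun s : ℝ => s ^ (p + 1) :=
  continuous_id.rpow_const fun _ => Or.inr (by linarith)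

theorem continuousOn_one_div_sqrt (hp : 1 < p) :
    ContinuousOn (fun s : ℝ => 1 / √(1 - s ^ (p + 1))) (Ico 0 1) := by
  have := continuous_rpow_add_one hp
  refine ContinuousOn.div continuousOn_const (by fun_prop) fun s hs => ?_
  exact (Real.sqrt_pos.2 (one_sub_rpow_pos hp hs)).ne'

theorem continuousOn_div_rpow {f : ℝ → ℝ} {q : ℝ} (hp : 1 < p) (hf : ContinuousOn f (Ico 0 1)) :
    ContinuousOn (fun s : ℝ => f s / (1 - s ^ (p + 1)) ^ q) (Ico 0 1) := by
  have := continuous_rpow_add_one hp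
  refine hf.div (ContinuousOn.rpow_const (by fun_prop) fun s hs => ?_) fun s hs => ?_
  · exact Or.inl (one_sub_rpow_pos hp hs).ne'
  · exact (Real.rpow_pos_of_pos (one_sub_rpow_pos hp hs) _).ne'

theorem intervalIntegrable_of_abs_le {f g : ℝ → ℝ} (hf : ContinuousOn f (Ico 0 1))
    (hg : IntervalIntegrable g volume 0 1) (h : ∀ s ∈ Ioo (0 : ℝ) 1, |f s| ≤ g s) :
    IntervalIntegrable f volume 0 1 := by
  rw [intervalIntegrable_iff_integrableOn_Ioo_of_le zero_le_one] at hg ⊢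
  refine Integrable.mono' hg
    ((hf.mono Ioo_subset_Ico_self).aestronglyMeasurable measurableSet_Ioo) ?_
  exact (ae_restrict_iff' measurableSet_Ioo).2 (Eventually.of_forall h)

theorem intervalIntegrable_one_sub_rpow :
    IntervalIntegrable (fun s : ℝ => (1 - s) ^ (-(1 / 2) : ℝ)) volume 0 1 := by
  simpa using ((intervalIntegral.intervalIntegrable_rpow' (a := 0) (b := 1)
    (by norm_num : (-1 : ℝ) < -(1 / 2))).comp_sub_left 1).symm

theorem intervalIntegrable_one_div_sqrt (hp : 1 < p) :
    IntervalIntegrable (fun s : ℝ => 1 / √(1 - s ^ (p + 1))) volume 0 1 := by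
  refine intervalIntegrable_of_abs_le (continuousOn_one_div_sqrt hp)
    intervalIntegrable_one_sub_rpow fun s hs => ?_
  have h1 : 0 < 1 - s := by linarith [hs.2]
  rw [Real.rpow_neg h1.le, ← Real.sqrt_eq_rpow, abs_of_nonneg (by positivity), ← one_div]
  exact one_div_le_one_div_of_le (Real.sqrt_pos.2 h1)
    (Real.sqrt_le_sqrt (one_sub_le hp ⟨hs.1.le, hs.2.le⟩))

theorem intervalIntegrable_mul_one_div_sqrt (hp : 1 < p) {f : ℝ → ℝ} (hf : Continuous f) :
    IntervalIntegrable (fun s : ℝ => f s * (1 / √(1 - s ^ (p + 1)))) volume 0 1 :=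
  (intervalIntegrable_one_div_sqrt hp).continuousOn_mul hf.continuousOn

/-- A factor `1 - s ≤ h` in the numerator lowers the singularity from `h ^ (-3/2)` to the integrable
`h ^ (-1/2)`. -/
theorem div_rpow_three_halves_le (hp : 1 < p) (hs : s ∈ Ioo (0 : ℝ) 1) {x C : ℝ}
    (hx : |x| ≤ C * (1 - s)) :
    |x / (1 - s ^ (p + 1)) ^ (3 / 2 : ℝ)| ≤ C * (1 / √(1 - s ^ (p + 1))) := by
  have h0 := one_sub_rpow_pos hp ⟨hs.1.le, hs.2⟩
  have h1 := one_sub_le hp ⟨hs.1.le, hs.2.le⟩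
  have hC : 0 ≤ C := nonneg_of_mul_nonneg_left ((abs_nonneg x).trans hx) (by linarith [hs.2])
  set k := √(1 - s ^ (p + 1)) with hk
  have hk0 : 0 < k := Real.sqrt_pos.2 h0
  have hk2 : k ^ 2 = 1 - s ^ (p + 1) := Real.sq_sqrt h0.le
  rw [rpow_three_halves h0.le, abs_div, abs_of_pos (pow_pos hk0 3), div_le_iff₀ (pow_pos hk0 3)]
  have h2 : C * (1 / k) * k ^ 3 = C * k ^ 2 := by field_simp
  rw [h2, hk2]
  exact hx.trans (mul_le_mul_of_nonneg_left h1 hC)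

theorem intervalIntegrable_div_three_halves (hp : 1 < p) {f : ℝ → ℝ} {C : ℝ}
    (hf : Continuous f) (h : ∀ s ∈ Ioo (0 : ℝ) 1, |f s| ≤ C * (1 - s)) :
    IntervalIntegrable (fun s : ℝ => f s / (1 - s ^ (p + 1)) ^ (3 / 2 : ℝ)) volume 0 1 :=
  intervalIntegrable_of_abs_le (continuousOn_div_rpow hp hf.continuousOn)
    ((intervalIntegrable_one_div_sqrt hp).const_mul C)
    fun s hs => div_rpow_three_halves_le hp hs (h s hs)

theorem div_rpow_five_halves_le (hp : 1 < p) (hs : s ∈ Ioo (0 : ℝ) 1) {x C : ℝ}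
    (hx : |x| ≤ C * (1 - s ^ (p + 1)) ^ 2) :
    |x / (1 - s ^ (p + 1)) ^ (5 / 2 : ℝ)| ≤ C * (1 / √(1 - s ^ (p + 1))) := by
  have h0 := one_sub_rpow_pos hp ⟨hs.1.le, hs.2⟩
  set k := √(1 - s ^ (p + 1)) with hk
  have hk0 : 0 < k := Real.sqrt_pos.2 h0
  have hk2 : k ^ 2 = 1 - s ^ (p + 1) := Real.sq_sqrt h0.le
  rw [rpow_five_halves h0.le, abs_div, abs_of_pos (pow_pos hk0 5), div_le_iff₀ (pow_pos hk0 5)]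
  have h2 : C * (1 / k) * k ^ 5 = C * (k ^ 2) ^ 2 := by field_simp
  rwa [h2, hk2]

theorem intervalIntegrable_div_five_halves (hp : 1 < p) {f : ℝ → ℝ} {C : ℝ}
    (hf : Continuous f) (h : ∀ s ∈ Ioo (0 : ℝ) 1, |f s| ≤ C * (1 - s ^ (p + 1)) ^ 2) :
    IntervalIntegrable (fun s : ℝ => f s / (1 - s ^ (p + 1)) ^ (5 / 2 : ℝ)) volume 0 1 :=
  intervalIntegrable_of_abs_le (continuousOn_div_rpow hp hf.continuousOn)
    ((intervalIntegrable_one_div_sqrt hp).const_mul C)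
    fun s hs => div_rpow_five_halves_le hp hs (h s hs)

/-- Differentiating the root gives `s ^ (p + 1) * h ^ (-3/2)`, and `s ^ (p + 1) = 1 - h` splits it
into the two powers of `h`. -/
theorem hasDerivAt_mul_one_div_sqrt (hp : 1 < p) (hs : s ∈ Ioo (0 : ℝ) 1) :
    HasDerivAt (fun s : ℝ => s * (1 / √(1 - s ^ (p + 1))))
      ((p + 1) / 2 * (1 / (1 - s ^ (p + 1)) ^ (3 / 2 : ℝ))
        - (p - 1) / 2 * (1 / √(1 - s ^ (p + 1)))) s := by
  have h0 := one_sub_rpow_pos hp ⟨hs.1.le, hs.2⟩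
  have h1 := ((Real.hasDerivAt_rpow_const (x := s) (p := p + 1)
    (Or.inl hs.1.ne')).const_sub 1).sqrt h0.ne'
  have hk0 : 0 < √(1 - s ^ (p + 1)) := Real.sqrt_pos.2 h0
  have hk2 : √(1 - s ^ (p + 1)) ^ 2 = 1 - s ^ (p + 1) := Real.sq_sqrt h0.le
  have h2 := (hasDerivAt_id s).mul ((hasDerivAt_const s (1 : ℝ)).div h1 hk0.ne')
  refine HasDerivAt.congr_deriv h2 ?_
  rw [rpow_three_halves h0.le]
  have hsp : s * s ^ p = s ^ (p + 1) := by
    rw [Real.rpow_add_one hs.1.ne']; ring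
  have hsp' : s * s ^ p = 1 - √(1 - s ^ (p + 1)) ^ 2 := by rw [hsp, hk2]; ring
  simp only [add_sub_cancel_right, id, Pi.div_apply]
  generalize √(1 - s ^ (p + 1)) = k at *
  generalize s ^ p = y at *
  field_simp
  linear_combination (p + 1) * hsp'

/-- Integration by parts against `(s h^{-1/2})' = ((p+1) h^{-3/2} - (p-1) h^{-1/2}) / 2`, where
`h = 1 - s^{p+1}`. -/
theorem integral_div_three_halves (hp : 1 < p) {φ φ' : ℝ → ℝ} {C : ℝ}
    (hφ : ∀ s, HasDerivAt φ (φ' s) s) (hφ' : Continuous φ')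
    (hb : ∀ s ∈ Icc (0 : ℝ) 1, |φ s| ≤ C * (1 - s)) :
    (p + 1) / 2 * ∫ s in (0 : ℝ)..1, φ s / (1 - s ^ (p + 1)) ^ (3 / 2 : ℝ) =
      -(∫ s in (0 : ℝ)..1, φ' s * s * (1 / √(1 - s ^ (p + 1))))
        + (p - 1) / 2 * ∫ s in (0 : ℝ)..1, φ s * (1 / √(1 - s ^ (p + 1))) := by
  have hφc : Continuous φ := continuous_iff_continuousAt.2 fun s => (hφ s).continuousAt
  have i1 := intervalIntegrable_div_three_halves hp hφc
    fun s hs => hb s (Ioo_subset_Icc_self hs)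
  have i2 := intervalIntegrable_mul_one_div_sqrt (f := fun s => φ' s * s) hp (by fun_prop)
  have i3 := intervalIntegrable_mul_one_div_sqrt hp hφc
  -- Only continuity at `s = 1` is delicate: there `|φ s| ≤ C * (1 - s)` beats `h ^ (-1/2) ≤ (1 - s)
  -- ^ (-1/2)`. Both boundary terms vanish, at `0` because of the factor `s`.
  have hcont : ContinuousOn (fun s : ℝ => φ s * (s * (1 / √(1 - s ^ (p + 1))))) (Icc 0 1) := by
    intro s hs
    rcases hs.2.eq_or_lt with rfl | h1
    · have h0 : φ 1 = 0 := by simpa using hb 1 ⟨zero_le_one, le_rfl⟩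
      have hlim : Tendsto (fun s : ℝ => C * √(1 - s)) (𝓝[Icc 0 1] 1) (𝓝 0) := by
        have : Continuous fun s : ℝ => C * √(1 - s) := by fun_prop
        simpa using (this.tendsto 1).mono_left (nhdsWithin_le_nhds (s := Icc (0 : ℝ) 1))
      rw [ContinuousWithinAt, h0, zero_mul]
      refine squeeze_zero_norm' ?_ hlim
      filter_upwards [self_mem_nhdsWithin] with s hs
      rcases hs.2.eq_or_lt with rfl | h1
      · simp [h0]
      have e1 : 0 < 1 - s := by linarith
      have e2 : 1 / √(1 - s ^ (p + 1)) ≤ 1 / √(1 - s) :=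
        one_div_le_one_div_of_le (Real.sqrt_pos.2 e1) (Real.sqrt_le_sqrt (one_sub_le hp hs))
      rw [Real.norm_eq_abs, abs_mul, abs_of_nonneg (mul_nonneg hs.1 (by positivity))]
      calc |φ s| * (s * (1 / √(1 - s ^ (p + 1)))) ≤ C * (1 - s) * (1 * (1 / √(1 - s))) := by
            have h1 := hb s hs
            refine mul_le_mul h1 (mul_le_mul hs.2 e2 (by positivity) zero_le_one)
              (mul_nonneg hs.1 (by positivity)) ((abs_nonneg _).trans h1)
        _ = C * √(1 - s) := by
            rw [one_mul, mul_assoc, mul_one_div, Real.div_sqrt]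
    · refine ContinuousWithinAt.mono_of_mem_nhdsWithin (s := Icc 0 1) (t := Ico 0 1) ?_ ?_
      · exact hφc.continuousWithinAt.mul (continuousWithinAt_id.mul
          (continuousOn_one_div_sqrt hp s ⟨hs.1, h1⟩))
      · filter_upwards [self_mem_nhdsWithin, nhdsWithin_le_nhds (Iio_mem_nhds h1)] with x hx hx1
        exact ⟨hx.1, hx1⟩
  have hder : ∀ s ∈ Ioo (0 : ℝ) 1, HasDerivAt
      (fun s : ℝ => φ s * (s * (1 / √(1 - s ^ (p + 1)))))
      (φ' s * s * (1 / √(1 - s ^ (p + 1)))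
        + (p + 1) / 2 * (φ s / (1 - s ^ (p + 1)) ^ (3 / 2 : ℝ))
        - (p - 1) / 2 * (φ s * (1 / √(1 - s ^ (p + 1))))) s := fun s hs =>
    ((hφ s).mul (hasDerivAt_mul_one_div_sqrt hp hs)).congr_deriv (by ring)
  have := intervalIntegral.integral_eq_sub_of_hasDerivAt_of_le zero_le_one hcont hder
    ((i2.add (i1.const_mul _)).sub (i3.const_mul _))
  rw [intervalIntegral.integral_sub (i2.add (i1.const_mul _)) (i3.const_mul _),
    intervalIntegral.integral_add i2 (i1.const_mul _), intervalIntegral.integral_const_mul,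
    intervalIntegral.integral_const_mul] at this
  have h0 : φ 1 = 0 := by simpa using hb 1 ⟨zero_le_one, le_rfl⟩
  rw [h0] at this
  simp only [zero_mul, mul_zero, sub_zero] at this
  linarith

/-- The substitution `s = sin θ ^ (2 / (p + 1))`. -/
theorem integral_comp_sin_rpow (hp : 1 < p) (F : ℝ → ℝ) :
    ∫ θ in (0 : ℝ)..(π / 2), F (sin θ ^ (2 / (p + 1))) * sin θ ^ ((1 - p) / (p + 1)) =
      (p + 1) / 2 * ∫ s in (0 : ℝ)..1, F s * (1 / √(1 - s ^ (p + 1))) := by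
  have hp1 : 0 < p + 1 := by linarith
  have hq : 0 < 2 / (p + 1) := by positivity
  have hpi := pi_pos
  have hsin : ∀ θ ∈ Ioo 0 (π / 2), 0 < sin θ := fun θ hθ =>
    sin_pos_of_mem_Ioo ⟨hθ.1, by linarith [hθ.2]⟩
  have hder : ∀ θ ∈ Ioo 0 (π / 2), HasDerivWithinAt (fun θ => sin θ ^ (2 / (p + 1)))
      (cos θ * (2 / (p + 1)) * sin θ ^ (2 / (p + 1) - 1)) (Ioo 0 (π / 2)) θ := fun θ hθ =>
    ((Real.hasDerivAt_sin θ).rpow_const (Or.inl (hsin θ hθ).ne')).hasDerivWithinAt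
  have hmono : StrictMonoOn (fun θ => sin θ ^ (2 / (p + 1))) (Icc 0 (π / 2)) := by
    intro a ha b hb hab
    refine Real.rpow_lt_rpow (sin_nonneg_of_mem_Icc ⟨ha.1, by linarith [ha.2]⟩) ?_ hq
    exact strictMonoOn_sin ⟨by linarith [ha.1], ha.2⟩ ⟨by linarith [hb.1], hb.2⟩ hab
  have e0 : sin 0 ^ (2 / (p + 1)) = 0 := by rw [sin_zero, Real.zero_rpow hq.ne']
  have e1 : sin (π / 2) ^ (2 / (p + 1)) = 1 := by rw [sin_pi_div_two, Real.one_rpow]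
  have him : (fun θ => sin θ ^ (2 / (p + 1))) '' Ioo 0 (π / 2) = Ioo 0 1 := by
    apply Subset.antisymm
    · rintro _ ⟨x, hx, rfl⟩
      constructor
      · exact Real.rpow_pos_of_pos (hsin x hx) _
      · refine lt_of_lt_of_eq ?_ e1
        exact hmono ⟨hx.1.le, hx.2.le⟩ ⟨by linarith, le_rfl⟩ hx.2
    · have hc : Continuous fun θ => sin θ ^ (2 / (p + 1)) :=
        continuous_sin.rpow_const fun _ => Or.inr hq.le
      have := intermediate_value_Ioo (by linarith : (0 : ℝ) ≤ π / 2) hc.continuousOn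
      rwa [e0, e1] at this
  have key := integral_image_eq_integral_abs_deriv_smul measurableSet_Ioo hder
    (hmono.injOn.mono Ioo_subset_Icc_self) (fun s => F s * (1 / √(1 - s ^ (p + 1))))
  rw [him] at key
  rw [intervalIntegral.integral_of_le (by linarith), intervalIntegral.integral_of_le zero_le_one,
    integral_Ioc_eq_integral_Ioo, integral_Ioc_eq_integral_Ioo, key, ← integral_const_mul]
  refine setIntegral_congr_fun measurableSet_Ioo fun θ hθ => ?_
  have hs := hsin θ hθ
  have hcos : 0 < cos θ := cos_pos_of_mem_Ioo ⟨by linarith [hθ.1], hθ.2⟩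
  have h1 : (sin θ ^ (2 / (p + 1))) ^ (p + 1) = sin θ ^ 2 := by
    rw [← Real.rpow_mul hs.le, div_mul_cancel₀ _ hp1.ne', Real.rpow_two]
  have h2 : √(1 - sin θ ^ 2) = cos θ := by
    rw [← Real.cos_sq', Real.sqrt_sq hcos.le]
  have h3 : 2 / (p + 1) - 1 = (1 - p) / (p + 1) := by field_simp; ring
  have h4 := Real.rpow_pos_of_pos hs ((1 - p) / (p + 1))
  simp only [smul_eq_mul]
  rw [h1, h2, h3, abs_of_pos (by positivity)]
  field_simp

theorem integral_comp_sin_rpow' (hp : 1 < p) (F : ℝ → ℝ) :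
    ∫ θ in (0 : ℝ)..(π / 2), F (sin θ ^ (2 / (p + 1))) * sin θ ^ ((3 - p) / (p + 1)) =
      (p + 1) / 2 * ∫ s in (0 : ℝ)..1, F s * s * (1 / √(1 - s ^ (p + 1))) := by
  rw [← integral_comp_sin_rpow hp fun s => F s * s]
  refine intervalIntegral.integral_congr_Ioo_of_le (by linarith [pi_pos]) fun θ hθ => ?_
  have hs : 0 < sin θ := sin_pos_of_mem_Ioo ⟨hθ.1, by linarith [hθ.2, pi_pos]⟩
  have : (3 - p) / (p + 1) = 2 / (p + 1) + (1 - p) / (p + 1) := by ring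
  rw [this, Real.rpow_add hs]
  ring

end Weight

/-! ### The oscillating coefficients as weighted integrals, and their size. -/

section Coefficients

variable {p : ℝ}

theorem C11_eq (hp : 1 < p) (α : ℝ) :
    C11 p α = ∫ s in (0 : ℝ)..1, s * (1 / √(1 - s ^ (p + 1))) * cos (2 * α * s) := by
  have := integral_comp_sin_rpow' hp fun s => cos (2 * α * s)
  rw [C11, this, ← mul_assoc]
  have hp1 : p + 1 ≠ 0 := by linarith
  rw [show 2 / (p + 1) * ((p + 1) / 2) = 1 by field_simp, one_mul]
  congr 1; ext s; ring

theorem C21_eq (hp : 1 < p) (α : ℝ) :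
    C21 p α = -(1 / 2) * ∫ s in (0 : ℝ)..1, s * (1 / √(1 - s ^ (p + 1))) * sin (2 * α * s) := by
  have := integral_comp_sin_rpow' hp fun s => sin (2 * α * s)
  rw [C21, this, ← mul_assoc]
  have hp1 : p + 1 ≠ 0 := by linarith
  rw [show -(1 / (p + 1)) * ((p + 1) / 2) = -(1 / 2) by field_simp]
  congr 2; ext s; ring

theorem C12_eq (hp : 1 < p) (α : ℝ) :
    C12 p α = (p - 1) / 4 * (∫ s in (0 : ℝ)..1,
        (sin (2 * α) - sin (2 * α * s)) * (1 / √(1 - s ^ (p + 1))))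
      + (p + 1) / 4 * ∫ s in (0 : ℝ)..1,
        (1 - s) / (1 - s ^ (p + 1)) ^ (3 / 2 : ℝ) * sin (2 * α * s) := by
  have := integral_comp_sin_rpow hp fun s => sin (2 * α) - sin (2 * α * s)
  rw [C12, this, ← mul_assoc]
  have hp1 : p + 1 ≠ 0 := by linarith
  rw [show (p - 1) / (2 * (p + 1)) * ((p + 1) / 2) = (p - 1) / 4 by field_simp; ring]

theorem intervalIntegrable_id_mul_one_div_sqrt (hp : 1 < p) :
    IntervalIntegrable (fun s : ℝ => s * (1 / √(1 - s ^ (p + 1)))) volume 0 1 :=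
  intervalIntegrable_mul_one_div_sqrt hp continuous_id

theorem tendsto_C21 (hp : 1 < p) : Tendsto (C21 p) atTop (𝓝 0) := by
  have := (tendsto_integral_mul_sin (intervalIntegrable_id_mul_one_div_sqrt hp)).const_mul
    (-(1 / 2))
  rw [mul_zero] at this
  exact this.congr fun α => (C21_eq hp α).symm

theorem intervalIntegrable_one_sub_div (hp : 1 < p) : IntervalIntegrable
    (fun s : ℝ => (1 - s) / (1 - s ^ (p + 1)) ^ (3 / 2 : ℝ)) volume 0 1 :=
  intervalIntegrable_div_three_halves (C := 1) hp (by fun_prop) fun s hs => by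
    rw [abs_of_pos (by linarith [hs.2]), one_mul]

theorem abs_integral_mul_le (hp : 1 < p) {f : ℝ → ℝ} {C : ℝ}
    (hb : ∀ s, |f s| ≤ C) :
    |∫ s in (0 : ℝ)..1, f s * (1 / √(1 - s ^ (p + 1)))| ≤ C * C0 p := by
  rw [C0, ← intervalIntegral.integral_const_mul, ← Real.norm_eq_abs]
  refine intervalIntegral.norm_integral_le_of_norm_le zero_le_one
    (Eventually.of_forall fun s _ => ?_) ((intervalIntegrable_one_div_sqrt hp).const_mul C)
  rw [norm_mul, Real.norm_eq_abs, Real.norm_eq_abs, abs_of_nonneg (by positivity : 0 ≤ 1 / √_)]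
  gcongr
  exact hb s

theorem C12_isBigO (hp : 1 < p) : C12 p =O[atTop] (fun _ => (1 : ℝ)) := by
  have h1 : (fun α : ℝ => ∫ s in (0 : ℝ)..1,
      (sin (2 * α) - sin (2 * α * s)) * (1 / √(1 - s ^ (p + 1)))) =O[atTop]
      (fun _ => (1 : ℝ)) := by
    refine IsBigO.of_bound (2 * C0 p) (Eventually.of_forall fun α => ?_)
    rw [norm_one, mul_one]
    refine abs_integral_mul_le hp fun s => (abs_sub _ _).trans ?_
    linarith [abs_sin_le_one (2 * α), abs_sin_le_one (2 * α * s)]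
  have h2 := (tendsto_integral_mul_sin (intervalIntegrable_one_sub_div hp)).isBigO_one ℝ
  refine ((h1.const_mul_left ((p - 1) / 4)).add (h2.const_mul_left ((p + 1) / 4))).congr_left
    fun α => (C12_eq hp α).symm

/-- The inner integrand is at most `(1 - y) ^ (-3/2)`, so its primitive is at most `2 * (1 - s) ^
(-1/2)`. This is integrable, and the Riemann-Lebesgue lemma applies. -/
theorem tendsto_C3 (hp : 1 < p) : Tendsto (C3 p) atTop (𝓝 0) := by
  set f : ℝ → ℝ := fun y => (1 - y ^ 2) / (1 - y ^ (p + 1)) ^ (5 / 2 : ℝ) with hf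
  have hfc : ContinuousOn f (Ico 0 1) := continuousOn_div_rpow hp (by fun_prop)
  have hfle : ∀ y ∈ Ico (0 : ℝ) 1, |f y| ≤ (1 - y) ^ (-(3 / 2) : ℝ) := by
    intro y hy
    have h0 := one_sub_rpow_pos hp hy
    have h1 := one_sub_le hp ⟨hy.1, hy.2.le⟩
    have h2 := one_sub_sq_le hp ⟨hy.1, hy.2.le⟩
    have h3 : 0 < 1 - y := by linarith [hy.2]
    have h4 : 0 ≤ 1 - y ^ 2 := by nlinarith [hy.1]
    have h5 : (1 - y ^ (p + 1)) ^ (5 / 2 : ℝ)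
        = (1 - y ^ (p + 1)) * (1 - y ^ (p + 1)) ^ (3 / 2 : ℝ) := by
      rw [← Real.rpow_one_add' h0.le (by norm_num)]; norm_num
    have h6 : 0 < (1 - y) ^ (3 / 2 : ℝ) := Real.rpow_pos_of_pos h3 _
    have h7 : (1 - y) ^ (3 / 2 : ℝ) ≤ (1 - y ^ (p + 1)) ^ (3 / 2 : ℝ) :=
      Real.rpow_le_rpow h3.le h1 (by norm_num)
    have h8 := h6.trans_le h7
    rw [abs_of_nonneg (by simp only [hf]; positivity), Real.rpow_neg h3.le, ← one_div,
      le_div_iff₀ h6]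
    simp only [hf]
    rw [h5, div_mul_eq_mul_div, div_le_one (by positivity)]
    gcongr
  have hbound : ∀ s ∈ Ioo (0 : ℝ) 1,
      |∫ y in (0 : ℝ)..s, f y| ≤ 2 * (1 - s) ^ (-(1 / 2) : ℝ) := by
    intro s hs
    have hs1 : 0 < 1 - s := by linarith [hs.2]
    have hd : ∀ y ∈ uIcc 0 s, HasDerivAt (fun y : ℝ => 2 * (1 - y) ^ (-(1 / 2) : ℝ))
        ((1 - y) ^ (-(3 / 2) : ℝ)) y := by
      intro y hy
      rw [uIcc_of_le hs.1.le] at hy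
      have h3 : 0 < 1 - y := by linarith [hy.2, hs.2]
      have := (((hasDerivAt_id y).const_sub 1).rpow_const (p := -(1 / 2))
        (Or.inl h3.ne')).const_mul 2
      refine HasDerivAt.congr_deriv this ?_
      simp only [id]
      rw [show (-(1 / 2) - 1 : ℝ) = -(3 / 2) by norm_num]
      ring
    have hi : IntervalIntegrable (fun y : ℝ => (1 - y) ^ (-(3 / 2) : ℝ)) volume 0 s := by
      refine ContinuousOn.intervalIntegrable (ContinuousOn.rpow_const (by fun_prop) fun y hy => ?_)
      rw [uIcc_of_le hs.1.le] at hy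
      exact Or.inl (by linarith [hy.2, hs.2])
    have h1 := intervalIntegral.integral_eq_sub_of_hasDerivAt hd hi
    have h2 : ‖∫ y in (0 : ℝ)..s, f y‖ ≤ ∫ y in (0 : ℝ)..s, (1 - y) ^ (-(3 / 2) : ℝ) :=
      intervalIntegral.norm_integral_le_of_norm_le hs.1.le
        (Eventually.of_forall fun y hy => hfle y ⟨hy.1.le, hy.2.trans_lt hs.2⟩) hi
    rw [h1, Real.norm_eq_abs] at h2
    have h3 : (0 : ℝ) < (1 - 0) ^ (-(1 / 2) : ℝ) := by norm_num
    linarith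
  have hcont : ContinuousOn (fun s => ∫ y in (0 : ℝ)..s, f y) (Ico 0 1) := by
    intro s hs
    obtain ⟨t, hst, ht1⟩ := exists_between hs.2
    have h0t : 0 < t := hs.1.trans_lt hst
    have h1 := intervalIntegral.continuousOn_primitive_interval (μ := volume) (a := 0) (b := t)
      ((hfc.mono (fun x hx => by
        rw [uIcc_of_le h0t.le] at hx
        exact ⟨hx.1, hx.2.trans_lt ht1⟩)).integrableOn_compact isCompact_uIcc)
    rw [uIcc_of_le h0t.le] at h1
    refine (h1 s ⟨hs.1, hst.le⟩).mono_of_mem_nhdsWithin ?_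
    filter_upwards [self_mem_nhdsWithin, nhdsWithin_le_nhds (Iio_mem_nhds hst)] with x hx hx1
    exact ⟨hx.1, le_of_lt hx1⟩
  have hint := intervalIntegrable_of_abs_le hcont
    (intervalIntegrable_one_sub_rpow.const_mul 2) hbound
  have := (tendsto_integral_mul_cos hint).const_mul (-(3 / 32) * (p + 1) ^ 2)
  rw [mul_zero] at this
  exact this

end Coefficients

end OscBif

/-! ### Taylor bound for the integrand, and the rescaled time map. -/

/-- Second order Taylor bound for `x ↦ (h + x) ^ (-1/2)`. -/
theorem abs_one_div_sqrt_add_sub_le {h b : ℝ} (hh : 0 < h) (hb : 0 ≤ b) :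
    |1 / √(h + b) - (1 / √h - 1 / 2 * (b / h ^ (3 / 2 : ℝ)) + 3 / 8 * (b ^ 2 / h ^ (5 / 2 : ℝ)))|
      ≤ (b / h) ^ 3 * (1 / √h) := by
  rw [OscBif.rpow_three_halves hh.le, OscBif.rpow_five_halves hh.le]
  -- With `b = h x` and `z = √(1 + x)` the remainder is rational in `z` and contains the factor `(z
  -- - 1) ^ 3`. The same factor divides `x ^ 3 = (z ^ 2 - 1) ^ 3`, leaving a polynomial inequality
  -- for `z ≥ 1`.
  obtain ⟨x, rfl⟩ : ∃ x, b = h * x := ⟨b / h, by field_simp⟩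
  have hx : 0 ≤ x := nonneg_of_mul_nonneg_right hb hh
  have hz2 : √(1 + x) ^ 2 = 1 + x := Real.sq_sqrt (by linarith)
  have hz1 : 1 ≤ √(1 + x) := Real.one_le_sqrt.2 (by linarith)
  have hk : 0 < √h := Real.sqrt_pos.2 hh
  have hk2 : √h ^ 2 = h := Real.sq_sqrt hh.le
  rw [show h + h * x = h * (1 + x) by ring, Real.sqrt_mul hh.le, mul_div_cancel_left₀ _ hh.ne']
  generalize √(1 + x) = z at *
  generalize √h = k at *
  obtain rfl : x = z ^ 2 - 1 := by linarith
  subst hk2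
  have hz0 : 0 < z := by linarith
  have e : 1 / (k * z) - (1 / k - 1 / 2 * (k ^ 2 * (z ^ 2 - 1) / k ^ 3)
      + 3 / 8 * ((k ^ 2 * (z ^ 2 - 1)) ^ 2 / k ^ 5))
      = -((z - 1) ^ 3 * (3 * z ^ 2 + 9 * z + 8) / (8 * z) * (1 / k)) := by
    field_simp; ring
  have hz : 0 ≤ z - 1 := by linarith
  rw [e, abs_neg, abs_of_nonneg (by positivity)]
  refine mul_le_mul_of_nonneg_right ?_ (by positivity)
  rw [div_le_iff₀ (by positivity), show (z ^ 2 - 1) ^ 3 = (z - 1) ^ 3 * (z + 1) ^ 3 by ring,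
    mul_assoc]
  refine mul_le_mul_of_nonneg_left ?_ (by positivity)
  have h1 : (2 : ℝ) ^ 3 ≤ (z + 1) ^ 3 := by gcongr; linarith
  have h2 : 0 ≤ z * (z - 1) := by positivity
  nlinarith [mul_nonneg h2 hz, mul_nonneg h2 hz0.le, mul_nonneg (mul_nonneg h2 hz) hz]

namespace OscBif

/-- The oscillating part of `∫ t in s..1, t * sin (α t) ^ 2`. -/
noncomputable def osc (α s : ℝ) : ℝ :=
  (sin (2 * α) - s * sin (2 * α * s)) / (4 * α) + (cos (2 * α) - cos (2 * α * s)) / (8 * α ^ 2)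

/-- The perturbation `(p + 1) * ∫ t in s..1, t * sin (α t) ^ 2`. -/
noncomputable def bump (p α s : ℝ) : ℝ := (p + 1) * ((1 - s ^ 2) / 4 - osc α s)

/-- The rescaled time map. -/
noncomputable def reducedTime (p α : ℝ) : ℝ :=
  ∫ s in (0 : ℝ)..1, 1 / √(1 - s ^ (p + 1) + α ^ (1 - p) * bump p α s)

variable {p α s : ℝ}

theorem continuous_osc (α : ℝ) : Continuous (osc α) := by
  unfold osc; fun_prop

theorem continuous_bump (p α : ℝ) : Continuous (bump p α) := by
  have := continuous_osc α
  unfold bump; fun_prop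

theorem hasDerivAt_bump (hα : 0 < α) (s : ℝ) :
    HasDerivAt (bump p α) (-((p + 1) * (s * sin (α * s) ^ 2))) s := by
  have hl : HasDerivAt (fun s => 2 * α * s) (2 * α) s := by
    simpa using (hasDerivAt_id s).const_mul (2 * α)
  have h1 := (((hasDerivAt_id s).mul hl.sin).const_sub (sin (2 * α))).div_const (4 * α)
  have h2 := (hl.cos.const_sub (cos (2 * α))).div_const (8 * α ^ 2)
  have h3 := ((hasDerivAt_pow 2 s).const_sub 1).div_const 4
  have h4 := (h3.sub (h1.add h2)).const_mul (p + 1)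
  refine HasDerivAt.congr_deriv h4 ?_
  have hc : sin (α * s) ^ 2 = (1 - cos (2 * α * s)) / 2 := by
    rw [mul_assoc, Real.cos_two_mul, Real.cos_sq']; ring
  rw [hc]
  simp only [id]
  field_simp
  push_cast
  ring

theorem bump_one (p α : ℝ) : bump p α 1 = 0 := by simp [bump, osc]

theorem bump_nonneg (hp : 1 < p) (hα : 0 < α) (hs : s ∈ Icc (0 : ℝ) 1) : 0 ≤ bump p α s := by
  have : AntitoneOn (bump p α) (Icc 0 1) := by
    refine antitoneOn_of_deriv_nonpos (convex_Icc 0 1) (continuous_bump p α).continuousOn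
      (fun x _ => (hasDerivAt_bump hα x).differentiableAt.differentiableWithinAt) fun x hx => ?_
    rw [interior_Icc] at hx
    rw [(hasDerivAt_bump hα x).deriv, neg_nonpos]
    have := hx.1
    positivity
  rw [← bump_one p α]
  exact this hs ⟨zero_le_one, le_rfl⟩ hs.2

/-- Both sides vanish at `s = 1`, and `sin ^ 2 ≤ 1` compares their derivatives. -/
theorem bump_le (hp : 1 < p) (hα : 0 < α) (hs : s ∈ Icc (0 : ℝ) 1) :
    bump p α s ≤ (p + 1) / 2 * (1 - s ^ 2) := by
  have hd : ∀ x, HasDerivAt (fun s => bump p α s - (p + 1) / 2 * (1 - s ^ 2))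
      ((p + 1) * x * (1 - sin (α * x) ^ 2)) x := fun x =>
    ((hasDerivAt_bump hα x).sub (((hasDerivAt_pow 2 x).const_sub 1).const_mul
      ((p + 1) / 2))).congr_deriv (by push_cast; ring)
  have : MonotoneOn (fun s => bump p α s - (p + 1) / 2 * (1 - s ^ 2)) (Icc 0 1) := by
    refine monotoneOn_of_deriv_nonneg (convex_Icc 0 1)
      (fun x _ => (hd x).continuousAt.continuousWithinAt)
      (fun x _ => (hd x).differentiableAt.differentiableWithinAt) fun x hx => ?_
    rw [interior_Icc] at hx
    rw [(hd x).deriv]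
    exact mul_nonneg (mul_nonneg (by linarith) hx.1.le) (sub_nonneg.2 (sin_sq_le_one _))
  have := this hs ⟨zero_le_one, le_rfl⟩ hs.2
  simp only [bump_one] at this
  linarith

/-- The constant does not depend on `α`: this keeps the ratio `ε * bump / h` of order `ε` up to `s =
1`, so that the Taylor expansion is uniform. -/
theorem bump_le_mul (hp : 1 < p) (hα : 0 < α) (hs : s ∈ Icc (0 : ℝ) 1) :
    bump p α s ≤ (p + 1) / 2 * (1 - s ^ (p + 1)) :=
  (bump_le hp hα hs).trans (mul_le_mul_of_nonneg_left (one_sub_sq_le hp hs) (by linarith))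

theorem potential_sub_potential (hp : 1 < p) (hα : 0 < α) (hs : 0 ≤ s) :
    potential p α - potential p (α * s) =
      α ^ (p + 1) / (p + 1) * (1 - s ^ (p + 1) + α ^ (1 - p) * bump p α s) := by
  have hp1 : p + 1 ≠ 0 := by linarith
  have h1 : α ^ (p + 1) * α ^ (1 - p) = α ^ 2 := by
    rw [← Real.rpow_add hα, ← Real.rpow_two]; ring_nf
  rw [potential_eq hp hα.le, potential_eq hp (by positivity), Real.mul_rpow hα.le hs, mul_add,
    ← mul_assoc (_ / _), div_mul_eq_mul_div (α ^ (p + 1)) (p + 1) (α ^ (1 - p)), h1, bump, osc,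
    ← mul_assoc 2 α s]
  field_simp
  ring

theorem IsBifurcationValue.eq_reducedTime {μ : ℝ} (hp : 1 < p) (hα : 0 < α)
    (h : IsBifurcationValue p α μ) :
    μ = 2 * (p + 1) * α ^ (1 - p) * reducedTime p α ^ 2 := by
  have hp1 : 0 < p + 1 := by linarith
  have hA : 0 < α ^ (p + 1) / (p + 1) := div_pos (Real.rpow_pos_of_pos hα _) hp1
  have h1 : timeMap p α = α / √(α ^ (p + 1) / (p + 1)) * reducedTime p α := by
    have := intervalIntegral.integral_comp_mul_left (a := 0) (b := 1)
      (fun u => 1 / √(potential p α - potential p u)) hα.ne'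
    rw [mul_zero, mul_one, smul_eq_mul, eq_inv_mul_iff_mul_eq₀ hα.ne',
      intervalIntegral.integral_of_le hα.le, integral_Ioc_eq_integral_Ioo] at this
    rw [timeMap, ← this, reducedTime, div_mul_eq_mul_div, mul_div_assoc]
    congr 1
    rw [← intervalIntegral.integral_div]
    refine intervalIntegral.integral_congr_Ioo_of_le zero_le_one fun s hs => ?_
    rw [potential_sub_potential hp hα hs.1.le, Real.sqrt_mul hA.le]
    field_simp
  rw [h.eq_timeMap hp hα, h1, mul_pow, div_pow, Real.sq_sqrt hA.le]
  have h2 : α ^ (1 - p) = α ^ 2 / α ^ (p + 1) := by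
    rw [← Real.rpow_two, ← Real.rpow_sub hα]; ring_nf
  rw [h2]
  have := Real.rpow_pos_of_pos hα (p + 1)
  field_simp

/-! ### Second order expansion of the rescaled time map. -/

section Expansion

theorem one_sub_sq_le_two_mul (s : ℝ) : 1 - s ^ 2 ≤ 2 * (1 - s) := by nlinarith [sq_nonneg (1 - s)]

theorem one_sub_sq_nonneg (hs : s ∈ Icc (0 : ℝ) 1) : 0 ≤ 1 - s ^ 2 := by nlinarith [hs.1, hs.2]

theorem abs_bump_le (hp : 1 < p) (hα : 0 < α) (hs : s ∈ Icc (0 : ℝ) 1) :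
    |bump p α s| ≤ (p + 1) * (1 - s) := by
  rw [abs_of_nonneg (bump_nonneg hp hα hs)]
  refine (bump_le hp hα hs).trans ?_
  have := mul_le_mul_of_nonneg_left (one_sub_sq_le_two_mul s) (by linarith : 0 ≤ (p + 1) / 2)
  linarith

theorem abs_bump_sq_le (hp : 1 < p) (hα : 0 < α) (hs : s ∈ Icc (0 : ℝ) 1) :
    |bump p α s ^ 2| ≤ ((p + 1) / 2) ^ 2 * (1 - s ^ (p + 1)) ^ 2 := by
  rw [abs_of_nonneg (sq_nonneg _), ← mul_pow]
  exact pow_le_pow_left₀ (bump_nonneg hp hα hs) (bump_le_mul hp hα hs) 2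

theorem intervalIntegrable_bump (hp : 1 < p) (hα : 0 < α) : IntervalIntegrable
    (fun s : ℝ => bump p α s / (1 - s ^ (p + 1)) ^ (3 / 2 : ℝ)) volume 0 1 :=
  intervalIntegrable_div_three_halves hp (continuous_bump p α)
    fun _ hs => abs_bump_le hp hα (Ioo_subset_Icc_self hs)

theorem intervalIntegrable_bump_sq (hp : 1 < p) (hα : 0 < α) : IntervalIntegrable
    (fun s : ℝ => bump p α s ^ 2 / (1 - s ^ (p + 1)) ^ (5 / 2 : ℝ)) volume 0 1 :=
  intervalIntegrable_div_five_halves hp ((continuous_bump p α).pow 2)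
    fun _ hs => abs_bump_sq_le hp hα (Ioo_subset_Icc_self hs)

theorem abs_reducedTime_sub_le (hp : 1 < p) (hα : 0 < α) :
    |reducedTime p α - (C0 p
      - α ^ (1 - p) / 2 * (∫ s in (0 : ℝ)..1, bump p α s / (1 - s ^ (p + 1)) ^ (3 / 2 : ℝ))
      + 3 / 8 * (α ^ (1 - p)) ^ 2 *
        ∫ s in (0 : ℝ)..1, bump p α s ^ 2 / (1 - s ^ (p + 1)) ^ (5 / 2 : ℝ))|
      ≤ (α ^ (1 - p)) ^ 3 * (((p + 1) / 2) ^ 3 * C0 p) := by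
  set ε := α ^ (1 - p) with hε
  have hε0 : 0 < ε := Real.rpow_pos_of_pos hα _
  have i0 := intervalIntegrable_one_div_sqrt hp
  have i1 := (intervalIntegrable_bump hp hα).const_mul (ε / 2)
  have i2 := (intervalIntegrable_bump_sq hp hα).const_mul (3 / 8 * ε ^ 2)
  have hle : ∀ s ∈ Ico (0 : ℝ) 1, 1 - s ^ (p + 1) ≤ 1 - s ^ (p + 1) + ε * bump p α s :=
    fun s hs => le_add_of_nonneg_right
      (mul_nonneg hε0.le (bump_nonneg hp hα ⟨hs.1, hs.2.le⟩))
  have i3 : IntervalIntegrable (fun s : ℝ => 1 / √(1 - s ^ (p + 1) + ε * bump p α s))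
      volume 0 1 := by
    refine intervalIntegrable_of_abs_le ?_ i0 fun s hs => ?_
    · have h1 := continuous_rpow_add_one hp
      have h2 := continuous_bump p α
      refine ContinuousOn.div continuousOn_const (by fun_prop) fun s hs => ?_
      exact (Real.sqrt_pos.2 ((one_sub_rpow_pos hp hs).trans_le (hle s hs))).ne'
    · have hs' : s ∈ Ico (0 : ℝ) 1 := ⟨hs.1.le, hs.2⟩
      rw [abs_of_nonneg (by positivity)]
      exact one_div_le_one_div_of_le (Real.sqrt_pos.2 (one_sub_rpow_pos hp hs'))
        (Real.sqrt_le_sqrt (hle s hs'))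
  rw [reducedTime, C0, ← intervalIntegral.integral_const_mul,
    ← intervalIntegral.integral_const_mul, ← intervalIntegral.integral_sub i0 i1,
    ← intervalIntegral.integral_add (i0.sub i1) i2,
    ← intervalIntegral.integral_sub i3 ((i0.sub i1).add i2),
    ← intervalIntegral.integral_const_mul, ← intervalIntegral.integral_const_mul,
    ← Real.norm_eq_abs]
  refine intervalIntegral.norm_integral_le_of_norm_le zero_le_one ?_
    ((i0.const_mul _).const_mul _)
  filter_upwards [Measure.ae_ne volume (1 : ℝ)] with s hs1 hs
  have hs' : s ∈ Icc (0 : ℝ) 1 := ⟨hs.1.le, hs.2⟩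
  have h0 := one_sub_rpow_pos hp ⟨hs.1.le, lt_of_le_of_ne hs.2 hs1⟩
  have hb := bump_nonneg hp hα hs'
  have key := abs_one_div_sqrt_add_sub_le h0 (mul_nonneg hε0.le hb)
  rw [Real.norm_eq_abs]
  calc _ = _ := by congr 1; ring
    _ ≤ _ := key
    _ ≤ (ε * ((p + 1) / 2)) ^ 3 * (1 / √(1 - s ^ (p + 1))) := by
        refine mul_le_mul_of_nonneg_right (pow_le_pow_left₀ (by positivity) ?_ 3) (by positivity)
        rw [div_le_iff₀ h0, mul_assoc]
        exact mul_le_mul_of_nonneg_left (bump_le_mul hp hα hs') hε0.le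
    _ = _ := by ring

theorem abs_osc_le (hα : 1 ≤ α) (hs : s ∈ Icc (0 : ℝ) 1) : |osc α s| ≤ 1 / α := by
  have hα0 : 0 < α := by linarith
  have h1 : |sin (2 * α) - s * sin (2 * α * s)| ≤ 2 := by
    refine (abs_sub _ _).trans ?_
    have : |s * sin (2 * α * s)| ≤ 1 := by
      rw [abs_mul, abs_of_nonneg hs.1]
      exact mul_le_one₀ hs.2 (abs_nonneg _) (abs_sin_le_one _)
    linarith [abs_sin_le_one (2 * α)]
  have h2 : |cos (2 * α) - cos (2 * α * s)| ≤ 2 := by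
    refine (abs_sub _ _).trans ?_
    linarith [abs_cos_le_one (2 * α), abs_cos_le_one (2 * α * s)]
  calc |osc α s| ≤ |sin (2 * α) - s * sin (2 * α * s)| / (4 * α)
        + |cos (2 * α) - cos (2 * α * s)| / (8 * α ^ 2) := by
        refine (abs_add_le _ _).trans (le_of_eq ?_)
        rw [abs_div, abs_div, abs_of_pos (by positivity : 0 < 4 * α),
          abs_of_pos (by positivity : 0 < 8 * α ^ 2)]
    _ ≤ 2 / (4 * α) + 2 / (8 * α) := by
        gcongr
        exact le_self_pow₀ hα two_ne_zero
    _ ≤ 1 / α := by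
        rw [div_add_div _ _ (by positivity) (by positivity),
          div_le_div_iff₀ (by positivity) (by positivity)]
        nlinarith [sq_nonneg α]

/-- Dominated convergence: `osc α s` tends to `0`, and `bump ^ 2 * h ^ (-5/2)` is at most a fixed
multiple of `h ^ (-1/2)`. -/
theorem tendsto_integral_bump_sq (hp : 1 < p) :
    Tendsto (fun α => 3 / 8 * ∫ s in (0 : ℝ)..1, bump p α s ^ 2 / (1 - s ^ (p + 1)) ^ (5 / 2 : ℝ))
      atTop (𝓝 (C2 p)) := by
  have e : C2 p = 3 / 8 * ∫ s in (0 : ℝ)..1,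
      ((p + 1) * ((1 - s ^ 2) / 4 - 0)) ^ 2 / (1 - s ^ (p + 1)) ^ (5 / 2 : ℝ) := by
    rw [C2, ← intervalIntegral.integral_const_mul, ← intervalIntegral.integral_const_mul]
    congr 1; ext s; ring
  rw [e]
  refine Tendsto.const_mul _ (intervalIntegral.tendsto_integral_filter_of_dominated_convergence
    (fun s => ((p + 1) / 2) ^ 2 * (1 / √(1 - s ^ (p + 1)))) ?_ ?_
    ((intervalIntegrable_one_div_sqrt hp).const_mul _) ?_)
  · filter_upwards [eventually_gt_atTop 0] with α hα
    have := (intervalIntegrable_bump_sq hp hα).1.aestronglyMeasurable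
    rwa [uIoc_of_le zero_le_one]
  · filter_upwards [eventually_gt_atTop 0] with α hα
    filter_upwards [Measure.ae_ne volume (1 : ℝ)] with s hs1 hs
    rw [uIoc_of_le zero_le_one] at hs
    exact div_rpow_five_halves_le hp ⟨hs.1, lt_of_le_of_ne hs.2 hs1⟩
      (abs_bump_sq_le hp hα ⟨hs.1.le, hs.2⟩)
  · refine Eventually.of_forall fun s hs => ?_
    rw [uIoc_of_le zero_le_one] at hs
    have hosc : Tendsto (fun α => osc α s) atTop (𝓝 0) := by
      refine squeeze_zero_norm' ?_ (tendsto_const_nhds.div_atTop tendsto_id (a := (1 : ℝ)))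
      filter_upwards [eventually_ge_atTop 1] with α hα
      exact abs_osc_le hα ⟨hs.1.le, hs.2⟩
    exact (((hosc.const_sub _).const_mul _).pow 2).div_const _

/-- The growth in `α` is harmless: the bound only serves integrability and the vanishing of the
boundary term, not the estimates. -/
theorem abs_sin_sub_le (hα : 0 < α) (hs : s ∈ Icc (0 : ℝ) 1) :
    |sin (2 * α) - sin (2 * α * s)| ≤ 2 * α * (1 - s) := by
  have := Real.lipschitzWith_sin.dist_le_mul (2 * α) (2 * α * s)
  rw [Real.dist_eq, Real.dist_eq, NNReal.coe_one, one_mul] at this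
  rwa [show 2 * α - 2 * α * s = 2 * α * (1 - s) by ring,
    abs_of_nonneg (mul_nonneg (by positivity) (sub_nonneg.2 hs.2))] at this

theorem abs_cos_sub_le (hα : 0 < α) (hs : s ∈ Icc (0 : ℝ) 1) :
    |cos (2 * α) - cos (2 * α * s)| ≤ 2 * α * (1 - s) := by
  have := Real.lipschitzWith_cos.dist_le_mul (2 * α) (2 * α * s)
  rw [Real.dist_eq, Real.dist_eq, NNReal.coe_one, one_mul] at this
  rwa [show 2 * α - 2 * α * s = 2 * α * (1 - s) by ring,
    abs_of_nonneg (mul_nonneg (by positivity) (sub_nonneg.2 hs.2))] at this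

theorem hasDerivAt_two_mul_mul (α s : ℝ) : HasDerivAt (fun s => 2 * α * s) (2 * α) s := by
  simpa using (hasDerivAt_id s).const_mul (2 * α)

/-- Integrating by parts differentiates the sine and yields a factor `2 * α`, which cancels the `1 /
α` in `osc`. This is how `C11` enters at the same order as `C1`. -/
theorem integral_sin_sub_div (hp : 1 < p) (hα : 0 < α) :
    (p + 1) / 2 * (∫ s in (0 : ℝ)..1,
        (sin (2 * α) - sin (2 * α * s)) / (1 - s ^ (p + 1)) ^ (3 / 2 : ℝ)) =
      2 * α * C11 p α + (p - 1) / 2 * ∫ s in (0 : ℝ)..1,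
        (sin (2 * α) - sin (2 * α * s)) * (1 / √(1 - s ^ (p + 1))) := by
  rw [integral_div_three_halves hp
    (fun s => (hasDerivAt_two_mul_mul α s).sin.const_sub (sin (2 * α))) (by fun_prop)
    (fun s hs => abs_sin_sub_le hα hs), C11_eq hp, ← intervalIntegral.integral_const_mul (2 * α),
    ← intervalIntegral.integral_neg]
  congr 1
  refine intervalIntegral.integral_congr fun s _ => ?_
  ring

theorem integral_cos_sub_div (hp : 1 < p) (hα : 0 < α) :
    (p + 1) / 2 * (∫ s in (0 : ℝ)..1,
        (cos (2 * α) - cos (2 * α * s)) / (1 - s ^ (p + 1)) ^ (3 / 2 : ℝ)) =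
      4 * α * C21 p α + (p - 1) / 2 * ∫ s in (0 : ℝ)..1,
        (cos (2 * α) - cos (2 * α * s)) * (1 / √(1 - s ^ (p + 1))) := by
  rw [integral_div_three_halves hp
    (fun s => (hasDerivAt_two_mul_mul α s).cos.const_sub (cos (2 * α))) (by fun_prop)
    (fun s hs => abs_cos_sub_le hα hs), C21_eq hp, ← mul_assoc,
    ← intervalIntegral.integral_const_mul (4 * α * -(1 / 2)), ← intervalIntegral.integral_neg]
  congr 1
  refine intervalIntegral.integral_congr fun s _ => ?_
  ring

/-- The contribution of first order in the perturbation. -/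
theorem integral_bump_div (hp : 1 < p) (hα : 0 < α) :
    -(1 / 2) * ∫ s in (0 : ℝ)..1, bump p α s / (1 - s ^ (p + 1)) ^ (3 / 2 : ℝ) =
      C1 p + 1 / 2 * C11 p α + 1 / 2 * C12 p α / α + (1 / 2 * C21 p α / α
        + (p - 1) / (16 * α ^ 2) * ∫ s in (0 : ℝ)..1,
          (cos (2 * α) - cos (2 * α * s)) * (1 / √(1 - s ^ (p + 1)))) := by
  have i1 : IntervalIntegrable (fun s : ℝ => (1 - s ^ 2) / (1 - s ^ (p + 1)) ^ (3 / 2 : ℝ))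
      volume 0 1 :=
    intervalIntegrable_div_three_halves (C := 2) hp (by fun_prop) fun s hs => by
      rw [abs_of_nonneg (one_sub_sq_nonneg (Ioo_subset_Icc_self hs))]
      exact one_sub_sq_le_two_mul s
  have i2 := intervalIntegrable_div_three_halves (f := fun s => sin (2 * α) - sin (2 * α * s)) hp
    (by fun_prop) fun s hs => abs_sin_sub_le hα (Ioo_subset_Icc_self hs)
  have i3 := intervalIntegrable_div_three_halves (f := fun s => cos (2 * α) - cos (2 * α * s)) hp
    (by fun_prop) fun s hs => abs_cos_sub_le hα (Ioo_subset_Icc_self hs)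
  have i4 : IntervalIntegrable
      (fun s : ℝ => (1 - s) / (1 - s ^ (p + 1)) ^ (3 / 2 : ℝ) * sin (2 * α * s)) volume 0 1 :=
    (intervalIntegrable_one_sub_div hp).mul_continuousOn (by fun_prop)
  -- Split `sin 2α - s sin 2αs` as `(sin 2α - sin 2αs) + (1 - s) sin 2αs`. Every numerator now
  -- vanishes at `s = 1`; the last summand is left as it stands and goes into `C12`.
  have e : ∀ s, bump p α s / (1 - s ^ (p + 1)) ^ (3 / 2 : ℝ) =
      (p + 1) / 4 * ((1 - s ^ 2) / (1 - s ^ (p + 1)) ^ (3 / 2 : ℝ))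
      - (p + 1) / (4 * α) * ((1 - s) / (1 - s ^ (p + 1)) ^ (3 / 2 : ℝ) * sin (2 * α * s))
      - (p + 1) / (4 * α) * ((sin (2 * α) - sin (2 * α * s)) / (1 - s ^ (p + 1)) ^ (3 / 2 : ℝ))
      - (p + 1) / (8 * α ^ 2)
        * ((cos (2 * α) - cos (2 * α * s)) / (1 - s ^ (p + 1)) ^ (3 / 2 : ℝ)) := by
    intro s
    rw [bump, osc]
    ring
  simp_rw [e]
  rw [intervalIntegral.integral_sub
      (((i1.const_mul _).sub (i4.const_mul _)).sub (i2.const_mul _)) (i3.const_mul _),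
    intervalIntegral.integral_sub ((i1.const_mul _).sub (i4.const_mul _)) (i2.const_mul _),
    intervalIntegral.integral_sub (i1.const_mul _) (i4.const_mul _),
    intervalIntegral.integral_const_mul, intervalIntegral.integral_const_mul,
    intervalIntegral.integral_const_mul, intervalIntegral.integral_const_mul, C12_eq hp, C1]
  have h1 := integral_sin_sub_div hp hα
  have h2 := integral_cos_sub_div hp hα
  generalize (∫ s in (0 : ℝ)..1,
    (sin (2 * α) - sin (2 * α * s)) / (1 - s ^ (p + 1)) ^ (3 / 2 : ℝ)) = I₁ at *
  generalize (∫ s in (0 : ℝ)..1,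
    (cos (2 * α) - cos (2 * α * s)) / (1 - s ^ (p + 1)) ^ (3 / 2 : ℝ)) = I₂ at *
  generalize (∫ s in (0 : ℝ)..1,
    (sin (2 * α) - sin (2 * α * s)) * (1 / √(1 - s ^ (p + 1)))) = I₃ at *
  generalize (∫ s in (0 : ℝ)..1,
    (cos (2 * α) - cos (2 * α * s)) * (1 / √(1 - s ^ (p + 1)))) = I₄ at *
  field_simp
  linear_combination (256 * α) * h1 + 128 * h2

/-- Three errors are added: the `C21` and cosine remainders of the first order term, the convergence
of the quadratic term, and the cubic Taylor remainder. The `C12` term is kept, since it is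
negligible only for `p < 2`. -/
theorem reducedTime_isLittleO (hp : 1 < p) (hp2 : p ≤ 2) :
    (fun α => reducedTime p α - (C0 p + (C1 p + 1 / 2 * C11 p α) * α ^ (1 - p)
      + (1 / 2 * C12 p α / α * α ^ (1 - p) + C2 p * (α ^ (1 - p)) ^ 2)))
      =o[atTop] fun α : ℝ => (α ^ (1 - p)) ^ 2 := by
  have hε : Tendsto (fun α : ℝ => α ^ (1 - p)) atTop (𝓝 0) := by
    have := tendsto_rpow_neg_atTop (by linarith : 0 < p - 1)
    simpa using this
  -- This is where `p ≤ 2` enters: `-1 ≤ 1 - p`.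
  have hinv : (fun α : ℝ => 1 / α) =O[atTop] fun α => α ^ (1 - p) := by
    refine IsBigO.of_bound 1 ?_
    filter_upwards [eventually_ge_atTop 1] with α hα
    have h0 : 0 < α := by linarith
    rw [one_mul, Real.norm_of_nonneg (by positivity),
      Real.norm_of_nonneg (Real.rpow_pos_of_pos h0 _).le, one_div, ← Real.rpow_neg_one]
    exact Real.rpow_le_rpow_of_exponent_le hα (by linarith)
  set Y : ℝ → ℝ := fun α => ∫ s in (0 : ℝ)..1,
    (cos (2 * α) - cos (2 * α * s)) * (1 / √(1 - s ^ (p + 1))) with hY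
  have hρ : (fun α => 1 / 2 * C21 p α + (p - 1) / 16 * Y α * (1 / α)) =o[atTop]
      fun _ => (1 : ℝ) := by
    have h1 : (fun α => 1 / 2 * C21 p α) =o[atTop] fun _ => (1 : ℝ) :=
      ((isLittleO_one_iff ℝ).2 (tendsto_C21 hp)).const_mul_left _
    have h2 : Y =O[atTop] fun _ => (1 : ℝ) := by
      refine IsBigO.of_bound (2 * C0 p) (Eventually.of_forall fun α => ?_)
      rw [norm_one, mul_one]
      refine abs_integral_mul_le hp fun s => (abs_sub _ _).trans ?_
      linarith [abs_cos_le_one (2 * α), abs_cos_le_one (2 * α * s)]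
    have h3 : (fun α : ℝ => 1 / α) =o[atTop] fun _ => (1 : ℝ) :=
      (isLittleO_one_iff ℝ).2 (tendsto_const_nhds.div_atTop tendsto_id)
    have h4 := (h2.const_mul_left ((p - 1) / 16)).mul_isLittleO h3
    simp only [mul_one] at h4
    exact h1.add h4
  have hquad : (fun α => 3 / 8 * (∫ s in (0 : ℝ)..1,
      bump p α s ^ 2 / (1 - s ^ (p + 1)) ^ (5 / 2 : ℝ)) - C2 p) =o[atTop] fun _ => (1 : ℝ) :=
    (isLittleO_one_iff ℝ).2 (by simpa using (tendsto_integral_bump_sq hp).sub_const (C2 p))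
  have t1 : (fun α => (1 / 2 * C21 p α + (p - 1) / 16 * Y α * (1 / α)) * (1 / α) * α ^ (1 - p))
      =o[atTop] fun α : ℝ => (α ^ (1 - p)) ^ 2 :=
    ((hρ.mul_isBigO hinv).mul_isBigO (isBigO_refl (fun α : ℝ => α ^ (1 - p)) atTop)).congr_right
      fun α => by ring
  have t2 : (fun α => (3 / 8 * (∫ s in (0 : ℝ)..1,
      bump p α s ^ 2 / (1 - s ^ (p + 1)) ^ (5 / 2 : ℝ)) - C2 p) * (α ^ (1 - p)) ^ 2)
      =o[atTop] fun α : ℝ => (α ^ (1 - p)) ^ 2 :=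
    (hquad.mul_isBigO (isBigO_refl (fun α : ℝ => (α ^ (1 - p)) ^ 2) atTop)).congr_right
      fun α => by ring
  have t3 : (fun α => reducedTime p α - (C0 p
      - α ^ (1 - p) / 2 * (∫ s in (0 : ℝ)..1, bump p α s / (1 - s ^ (p + 1)) ^ (3 / 2 : ℝ))
      + 3 / 8 * (α ^ (1 - p)) ^ 2 *
        ∫ s in (0 : ℝ)..1, bump p α s ^ 2 / (1 - s ^ (p + 1)) ^ (5 / 2 : ℝ)))
      =o[atTop] fun α : ℝ => (α ^ (1 - p)) ^ 2 := by
    have h1 : (fun α => reducedTime p α - (C0 p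
      - α ^ (1 - p) / 2 * (∫ s in (0 : ℝ)..1, bump p α s / (1 - s ^ (p + 1)) ^ (3 / 2 : ℝ))
      + 3 / 8 * (α ^ (1 - p)) ^ 2 *
        ∫ s in (0 : ℝ)..1, bump p α s ^ 2 / (1 - s ^ (p + 1)) ^ (5 / 2 : ℝ)))
        =O[atTop] fun α : ℝ => (α ^ (1 - p)) ^ 3 := by
      refine IsBigO.of_bound (((p + 1) / 2) ^ 3 * C0 p) ?_
      filter_upwards [eventually_gt_atTop 0] with α hα
      have := Real.rpow_pos_of_pos hα (1 - p)
      rw [Real.norm_eq_abs, Real.norm_of_nonneg (by positivity),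
        mul_comm (((p + 1) / 2) ^ 3 * C0 p)]
      exact abs_reducedTime_sub_le hp hα
    have h2 := (((isLittleO_one_iff ℝ).2 hε).mul_isBigO
      (isBigO_refl (fun α : ℝ => (α ^ (1 - p)) ^ 2) atTop)).congr_right
      (g₂ := fun α : ℝ => (α ^ (1 - p)) ^ 2) fun α => by ring
    exact h1.trans_isLittleO (h2.congr_left fun α => by ring)
  refine ((t1.add t2).add t3).congr' ?_ EventuallyEq.rfl
  filter_upwards [eventually_gt_atTop 0] with α hα
  have h1 := integral_bump_div hp hα
  have h2 : 1 / 2 * C21 p α / α + (p - 1) / (16 * α ^ 2) * Y α =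
      (1 / 2 * C21 p α + (p - 1) / 16 * Y α * (1 / α)) * (1 / α) := by
    field_simp
  rw [h2] at h1
  linear_combination (-α ^ (1 - p)) * h1

end Expansion

end OscBif

theorem theorem1p4 (p : ℝ) (hp : 1 < p) (hp2 : p ≤ 2) :
    (∀ α : ℝ, 0 < α → ∃! m : ℝ, OscBif.IsBifurcationValue p α m) ∧
    ∀ μ : ℝ → ℝ, (∀ α : ℝ, 0 < α → OscBif.IsBifurcationValue p α (μ α)) →
      (p < 2 → ∃ r : ℝ → ℝ, r =o[atTop] (fun α : ℝ => α ^ (2 * (1 - p))) ∧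
        ∀ᶠ α : ℝ in atTop,
          μ α = 2 * (p + 1) * α ^ (1 - p) *
            (OscBif.C0 p + (OscBif.C1 p + 1 / 2 * OscBif.C11 p α) * α ^ (1 - p)
              + (OscBif.C2 p + OscBif.C3 p α) * α ^ (2 * (1 - p)) + r α) ^ 2) ∧
      (p = 2 → ∃ r : ℝ → ℝ, r =o[atTop] (fun α : ℝ => α ^ (-2 : ℝ)) ∧
        ∀ᶠ α : ℝ in atTop,
          μ α = 6 * α ^ (-1 : ℝ) *
            (OscBif.C0 2 + (OscBif.C1 2 + 1 / 2 * OscBif.C11 2 α) * α ^ (-1 : ℝ)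
              + (1 / 2 * OscBif.C12 2 α + 1 / 2 * OscBif.C21 2 α
                  + OscBif.C2 2 + OscBif.C3 2 α) * α ^ (-2 : ℝ) + r α) ^ 2) := by
  refine ⟨fun α hα => OscBif.existsUnique_isBifurcationValue hp hα, fun μ hμ => ?_⟩
  have hexp := OscBif.reducedTime_isLittleO hp hp2
  -- Since `C3` tends to `0`, including it in the expansion changes only the remainder.
  have hC3 : (fun α : ℝ => OscBif.C3 p α * (α ^ (1 - p)) ^ 2) =o[atTop]
      fun α : ℝ => (α ^ (1 - p)) ^ 2 := by
    simpa using ((isLittleO_one_iff ℝ).2 (OscBif.tendsto_C3 hp)).mul_isBigO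
      (isBigO_refl (fun α : ℝ => (α ^ (1 - p)) ^ 2) atTop)
  have hsq : ∀ α : ℝ, 0 < α → (α ^ (1 - p)) ^ 2 = α ^ (2 * (1 - p)) := fun α hα => by
    rw [mul_comm, Real.rpow_mul hα.le, Real.rpow_two]
  constructor
  · intro hlt
    -- For `p < 2`, `1 / α` is smaller than `α ^ (1 - p)` by the factor `α ^ (-(2 - p))`, so the
    -- bounded `C12` drops out.
    have hC12 : (fun α : ℝ => 1 / 2 * OscBif.C12 p α / α * α ^ (1 - p)) =o[atTop]
        fun α : ℝ => (α ^ (1 - p)) ^ 2 := by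
      have h1 : (fun α : ℝ => 1 / α) =o[atTop] fun α : ℝ => α ^ (1 - p) := by
        have h0 := ((isLittleO_one_iff ℝ).2 (tendsto_rpow_neg_atTop (sub_pos.2 hlt))).mul_isBigO
          (isBigO_refl (fun α : ℝ => α ^ (1 - p)) atTop)
        refine h0.congr' ?_ (Eventually.of_forall fun α => one_mul _)
        filter_upwards [eventually_gt_atTop 0] with α hα
        rw [← Real.rpow_add hα, show -(2 - p) + (1 - p) = -1 by ring, Real.rpow_neg_one, one_div]
      exact ((((OscBif.C12_isBigO hp).const_mul_left (1 / 2)).mul_isLittleO h1).mul_isBigO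
        (isBigO_refl (fun α : ℝ => α ^ (1 - p)) atTop)).congr
        (fun α => by ring) fun α => by ring
    refine ⟨fun α => OscBif.reducedTime p α - (OscBif.C0 p
      + (OscBif.C1 p + 1 / 2 * OscBif.C11 p α) * α ^ (1 - p)
      + (OscBif.C2 p + OscBif.C3 p α) * α ^ (2 * (1 - p))), ?_, ?_⟩
    · refine ((hexp.add hC12).sub hC3).congr' ?_ ?_
      · filter_upwards [eventually_gt_atTop 0] with α hα
        rw [← hsq α hα]; ring
      · filter_upwards [eventually_gt_atTop 0] with α hα using hsq α hα
    · filter_upwards [eventually_gt_atTop 0] with α hα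
      rw [add_sub_cancel]
      exact (hμ α hα).eq_reducedTime hp hα
  · rintro rfl
    have h12 : (1 - 2 : ℝ) = -1 := by norm_num
    -- For `p = 2` the `C12` term is exactly of order `α ^ (-2)` and stays, while `C21` is inserted
    -- at the cost of another `o(α ^ (-2))`.
    have hC21 : (fun α : ℝ => 1 / 2 * OscBif.C21 2 α * (α ^ (1 - 2 : ℝ)) ^ 2) =o[atTop]
        fun α : ℝ => (α ^ (1 - 2 : ℝ)) ^ 2 := by
      simpa using (((isLittleO_one_iff ℝ).2 (OscBif.tendsto_C21 hp)).const_mul_left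
        (1 / 2)).mul_isBigO (isBigO_refl (fun α : ℝ => (α ^ (1 - 2 : ℝ)) ^ 2) atTop)
    rw [h12] at hexp hC3 hC21 hsq
    rw [show (2 * -1 : ℝ) = -2 by norm_num] at hsq
    refine ⟨fun α => OscBif.reducedTime 2 α - (OscBif.C0 2
      + (OscBif.C1 2 + 1 / 2 * OscBif.C11 2 α) * α ^ (-1 : ℝ)
      + (1 / 2 * OscBif.C12 2 α + 1 / 2 * OscBif.C21 2 α
          + OscBif.C2 2 + OscBif.C3 2 α) * α ^ (-2 : ℝ)), ?_, ?_⟩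
    · refine ((hexp.sub hC21).sub hC3).congr' ?_ ?_
      · filter_upwards [eventually_gt_atTop 0] with α hα
        rw [← hsq α hα, div_eq_mul_inv _ α, ← Real.rpow_neg_one α]; ring
      · filter_upwards [eventually_gt_atTop 0] with α hα using hsq α hα
    · filter_upwards [eventually_gt_atTop 0] with α hα
      rw [add_sub_cancel]
      have := (hμ α hα).eq_reducedTime hp hα
      rw [h12] at this
      rw [this]; norm_num
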